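/- Let $n\ge 3$. Identify $\mathbb{H}^n$ with $\mathbb{R}^{4n}$ and the purely imaginary quaternions with $\mathbb{R}^3$, and let $\operatorname{Hopf}(q)=\bar q\,\mathbf{i}\,q$. The space $\mathscr{A}_3(n)=(\mathbb{R}^3)^n$ of $n$-edge polygonal arms (lists of edge vectors $(\vec e_1,\dots,\vec e_n)$) carries the Hopf-Gaussian measure $\mathrm{H}$, the pushforward of the standard Gaussian measure on $\mathbb{H}^n$ under the coordinatewise Hopf map. The linear subspace $\mathscr{P}_3(n)=\{\sum_i\vec e_i=\vec 0\}$ of closed $n$-gons carries the corresponding subspace probability measure, also called Hopf-Gaussian ($\mathrm{H}$ conditioned on closure): the continuous $[0,\infty]$-valued density of $\mathrm{H}$ with respect to Lebesgue measure on $\mathbb{R}^{3n}$, restricted to $\mathscr{P}_3(n)$, taken with respect to the codimension-$3$ Hausdorff measure there, and normalized to total mass $1$. Then, for any two distinct edges $\vec e_i,\vec e_j$ (in particular for two consecutive edges, including $\vec e_n,\vec e_1$), the turning angle $\theta\in[0,\pi]$, i.e. the angle between the vectors $\vec e_i$ and $\vec e_j$, has expected value on $\mathscr{P}_3(n)$ \[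 E(\theta)=\frac{\pi}{2}+\frac{\pi}{4}\,\frac{2}{2n-3}=\frac{(n-1)\pi}{2n-3}. \] -/

import Mathlib

open MeasureTheory Module
open scoped ENNReal Quaternion

noncomputable section

namespace HopfGaussian

/-- The space of `n`-edge polygonal arms in `ℝ³` up to translation: an arm is its list of edge
vectors, and the space carries the Euclidean structure of `ℝ³ⁿ`. -/
abbrev Arm (n : ℕ) : Type := PiLp 2 (fun _ : Fin n => EuclideanSpace ℝ (Fin 3))

/-- The linear subspace of closed `n`-edge polygons: the edges sum to zero. -/
def ClosedPolygon (n : ℕ) : Submodule ℝ (Arm n) where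
  carrier := {e | ∑ i, e i = 0}
  add_mem' := by
    intro a b ha hb
    simp only [Set.mem_ofPred_eq] at ha hb ⊢
    simp [Finset.sum_add_distrib, ha, hb]
  zero_mem' := by simp
  smul_mem' := by
    intro c a ha
    simp only [Set.mem_ofPred_eq] at ha ⊢
    simp [← Finset.smul_sum, ha]

/-- The quaternion unit `i`. -/
def unitI : ℍ[ℝ] := ⟨0, 1, 0, 0⟩

/-- The Hopf map `q ↦ q̄ i q` from the quaternions to the purely imaginary quaternions, the latter
identified with `ℝ³`. -/
def hopf (q : ℍ[ℝ]) : EuclideanSpace ℝ (Fin 3) :=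
  !₂[(star q * unitI * q).imI, (star q * unitI * q).imJ, (star q * unitI * q).imK]

theorem hopf_eq (q : ℍ[ℝ]) : hopf q =
    !₂[q.re ^ 2 + q.imI ^ 2 - q.imJ ^ 2 - q.imK ^ 2, 2 * q.imI * q.imJ - 2 * q.re * q.imK,
      2 * q.re * q.imJ + 2 * q.imI * q.imK] := by
  have h0 : unitI.re = 0 := rfl
  have h1 : unitI.imI = 1 := rfl
  have h2 : unitI.imJ = 0 := rfl
  have h3 : unitI.imK = 0 := rfl
  ext k
  fin_cases k <;>
    simp [hopf, h0, h1, h2, h3, Quaternion.imI_mul, Quaternion.imJ_mul, Quaternion.imK_mul] <;> ring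

/-- The coordinatewise Hopf map `ℍⁿ → ℝ³ⁿ`, with `ℍ` written as `ℝ⁴`. -/
def hopfArm (n : ℕ) (q : Fin n → Fin 4 → ℝ) : Arm n :=
  WithLp.toLp 2 fun i => hopf ⟨q i 0, q i 1, q i 2, q i 3⟩

/-- The standard Gaussian measure on `ℍⁿ = ℝ⁴ⁿ`. -/
def gaussianH (n : ℕ) : Measure (Fin n → Fin 4 → ℝ) :=
  Measure.pi fun _ => Measure.pi fun _ => ProbabilityTheory.gaussianReal 0 1

/-- The Hopf-Gaussian measure on `n`-edge arms. -/
def armMeasure (n : ℕ) : Measure (Arm n) := (gaussianH n).map (hopfArm n)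

/-- `ρ` is the continuous density of `μ` with respect to Lebesgue measure on `ℝ³ⁿ`. Continuity is
that of maps into `[0, ∞]`, so that `ρ` may have poles. There is at most one such `ρ`. -/
def IsContinuousDensity {n : ℕ} (μ : Measure (Arm n)) (ρ : Arm n → ℝ≥0∞) : Prop :=
  Continuous ρ ∧ μ = (volume : Measure (Arm n)).withDensity ρ

theorem IsContinuousDensity.unique {n : ℕ} {μ : Measure (Arm n)} {ρ₁ ρ₂ : Arm n → ℝ≥0∞}
    (h₁ : IsContinuousDensity μ ρ₁) (h₂ : IsContinuousDensity μ ρ₂) : ρ₁ = ρ₂ := by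
  have h := (withDensity_eq_iff_of_sigmaFinite (μ := (volume : Measure (Arm n)))
    h₁.1.measurable.aemeasurable h₂.1.measurable.aemeasurable).1 (h₁.2.symm.trans h₂.2)
  exact (h₁.1.ae_eq_iff_eq volume h₂.1).1 h

/-- The density `ρ` restricted to the subspace of closed polygons, as a measure with respect to the
Hausdorff measure of the dimension of that subspace (so of codimension 3). -/
def restrictedMeasure {n : ℕ} (ρ : Arm n → ℝ≥0∞) : Measure (ClosedPolygon n) :=
  (Measure.hausdorffMeasure (finrank ℝ (ClosedPolygon n) : ℝ)).withDensity fun e => ρ e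

open Classical in
/-- The subspace probability measure on closed polygons inherited from a measure `μ` on arms, that
is, `μ` conditioned on closure: the continuous density of `μ` is restricted to the subspace of
closed polygons and normalized to total mass one there. It is zero if `μ` has no such density. -/
def subspaceMeasure {n : ℕ} (μ : Measure (Arm n)) : Measure (ClosedPolygon n) :=
  if h : ∃ ρ, IsContinuousDensity μ ρ then
    (restrictedMeasure h.choose Set.univ)⁻¹ • restrictedMeasure h.choose
  else 0

theorem subspaceMeasure_eq {n : ℕ} {μ : Measure (Arm n)} {ρ : Arm n → ℝ≥0∞}
    (h : IsContinuousDensity μ ρ) :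
    subspaceMeasure μ = (restrictedMeasure ρ Set.univ)⁻¹ • restrictedMeasure ρ := by
  have hex : ∃ ρ, IsContinuousDensity μ ρ := ⟨ρ, h⟩
  rw [subspaceMeasure, dif_pos hex, hex.choose_spec.unique h]

/-- The Hopf-Gaussian measure on closed `n`-edge polygons. -/
def closedMeasure (n : ℕ) : Measure (ClosedPolygon n) := subspaceMeasure (armMeasure n)

/-- The turning angle from the edge `e i` to the edge `e j`, in `[0, π]`: it is `0` if the two edges
point in the same direction. -/
def turningAngle {n : ℕ} (i j : Fin n) (e : ClosedPolygon n) : ℝ :=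
  InnerProductGeometry.angle ((e : Arm n) i) ((e : Arm n) j)

end HopfGaussian

end

noncomputable section

namespace HopfGaussian

open MeasureTheory Module Set Filter Topology
open scoped ENNReal Quaternion

/-! The characteristic function of the Hopf image of a Gaussian quaternion is `1 / (1 + 4‖ξ‖²)`
(`charFun_map_hopfFour`). This equals `∫ e^{-t} e^{-4t‖ξ‖²} dt`, so an edge is a centred Gaussian
vector of covariance `8t` run for an exponential time `t`, with density `besselE 0`. Gaussian
densities form a semigroup under convolution and the exponential times add up to gamma times, so `k
+ 1` independent edges sum to a vector with density `besselE k`. With `n = m + 3`, the joint density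
of two edges `a`, `b` of a closed polygon is therefore proportional to `besselE 0 a * besselE 0 b *
besselE m (a + b)`, with total mass `besselE (m + 2) 0`.

The angle between `a` and `b` is `π` times the probability that a Gaussian random plane separates
them (`lintegral_heatE_mul_opposite_inner`). By rotation invariance all planes contribute equally,
so it suffices to find the probability that the first coordinates of `a` and `b` have opposite
signs.

At fixed times of total `T`, the other two coordinates contribute the factor `1 / (16πT)`. Since
`e^{-T} / T = ∫_1^∞ e^{-lT} dl`, the problem becomes an integral over rates `l > 1` of the same
problem on the line (`lintegral_opposite_mul_besselE`). There the densities are Laplace, and a pair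
of opposite signs has the sum distribution of a single variable, up to the factor `1 / (2l)`
(`lintegral_bessel_opposite`). The closed polygon thus loses one edge, leaving `bessel (m + 1) l 0 /
(2l)`, a multiple of `l ^ (-(m + 5/2))`. Integrating over `l > 1` and dividing by `besselE (m + 2)
0` gives `(m + 2) / (2m + 3) = (n - 1) / (2n - 3)`. -/

/-! ### Gamma mixtures of Gaussians on the line -/

/-- The Gaussian density on the line with variance `8 t`. -/
def heat (t x : ℝ) : ℝ≥0∞ :=
  ENNReal.ofReal ((√(16 * Real.pi * t))⁻¹ * Real.exp (-(x ^ 2 / (16 * t))))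

/-- The weight `e^{-l t} t ^ k / k!` of the gamma distributions. -/
def gammaWeight (k : ℕ) (l t : ℝ) : ℝ≥0∞ :=
  ENNReal.ofReal (Real.exp (-(l * t)) * t ^ k / k.factorial)

/-- The gamma mixture of centred Gaussian densities on the line. -/
def bessel (k : ℕ) (l x : ℝ) : ℝ≥0∞ :=
  ∫⁻ t in Ioi (0 : ℝ), gammaWeight k l t * heat t x

@[fun_prop]
theorem measurable_heat : Measurable fun p : ℝ × ℝ => heat p.1 p.2 := by
  unfold heat; fun_prop

@[fun_prop]
theorem Measurable.heat {α : Type*} [MeasurableSpace α] {f g : α → ℝ} (hf : Measurable f)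
    (hg : Measurable g) : Measurable fun a => heat (f a) (g a) :=
  measurable_heat.comp (hf.prodMk hg)

@[fun_prop]
theorem measurable_gammaWeight (k : ℕ) (l : ℝ) : Measurable (gammaWeight k l) := by
  unfold gammaWeight; fun_prop

@[fun_prop]
theorem Measurable.gammaWeight {α : Type*} [MeasurableSpace α] (k : ℕ) {f g : α → ℝ}
    (hf : Measurable f) (hg : Measurable g) : Measurable fun a => gammaWeight k (f a) (g a) := by
  unfold HopfGaussian.gammaWeight; fun_prop

@[fun_prop]
theorem measurable_bessel (k : ℕ) (l : ℝ) : Measurable (bessel k l) := by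
  unfold bessel
  apply Measurable.lintegral_prod_right' (f := fun p : ℝ × ℝ => gammaWeight k l p.2 * heat p.2 p.1)
  fun_prop

theorem heat_neg (t x : ℝ) : heat t (-x) = heat t x := by simp [heat]

theorem bessel_neg (k : ℕ) (l x : ℝ) : bessel k l (-x) = bessel k l x := by
  simp [bessel, heat_neg]

theorem lintegral_exp_neg_mul_sq {b : ℝ} (hb : 0 < b) :
    ∫⁻ x : ℝ, ENNReal.ofReal (Real.exp (-b * x ^ 2)) = ENNReal.ofReal √(Real.pi / b) := by
  rw [← integral_gaussian, ofReal_integral_eq_lintegral_ofReal (integrable_exp_neg_mul_sq hb)]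
  exact Filter.Eventually.of_forall fun x => (Real.exp_pos _).le

theorem lintegral_heat {t : ℝ} (ht : 0 < t) : ∫⁻ x, heat t x = 1 := by
  have h : ∀ x, heat t x = ENNReal.ofReal (√(16 * Real.pi * t))⁻¹ *
      ENNReal.ofReal (Real.exp (-(1 / (16 * t)) * x ^ 2)) := by
    intro x
    rw [heat, ENNReal.ofReal_mul (by positivity)]
    ring_nf
  simp_rw [h]
  rw [lintegral_const_mul _ (by fun_prop), lintegral_exp_neg_mul_sq (by positivity),
    ← ENNReal.ofReal_mul (by positivity)]
  have : Real.pi / (1 / (16 * t)) = 16 * Real.pi * t := by field_simp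
  rw [this, inv_mul_cancel₀ (by positivity), ENNReal.ofReal_one]

theorem lintegral_heat_mul_heat {s t : ℝ} (hs : 0 < s) (ht : 0 < t) (y : ℝ) :
    ∫⁻ x, heat s x * heat t (y + x) = heat (s + t) y := by
  have hpi := Real.pi_pos
  -- Completing the square in `x`; what remains is a translated Gaussian of total mass one.
  have h : ∀ x, heat s x * heat t (y + x) = heat (s + t) y *
      heat (s * t / (s + t)) (x + y * s / (s + t)) := by
    intro x
    unfold heat
    rw [← ENNReal.ofReal_mul (by positivity), ← ENNReal.ofReal_mul (by positivity)]
    congr 1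
    have e : ∀ a b c d : ℝ, a⁻¹ * c * (b⁻¹ * d) = (a * b)⁻¹ * (c * d) := fun a b c d => by
      rw [mul_inv]; ring
    rw [e, e, ← Real.exp_add, ← Real.exp_add, ← Real.sqrt_mul (by positivity),
      ← Real.sqrt_mul (by positivity)]
    congr 2
    · congr 1; field_simp
    · field_simp; ring
  simp_rw [h]
  rw [lintegral_const_mul _ (by fun_prop),
    lintegral_add_right_eq_self (fun x => heat (s * t / (s + t)) x), lintegral_heat (by positivity),
    mul_one]

/-- The exponential factors depend on `s` and `t` only through `u = s + t`. For fixed `u` what is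
left is `∫_0^u t^k / k! dt = u^(k+1) / (k+1)!`. -/
theorem lintegral_Ioi_gammaWeight_add (k : ℕ) (l : ℝ) {F : ℝ → ℝ≥0∞} (hF : Measurable F) :
    ∫⁻ t in Ioi (0 : ℝ), ∫⁻ s in Ioi (0 : ℝ), gammaWeight 0 l s * gammaWeight k l t * F (s + t) =
      ∫⁻ u in Ioi (0 : ℝ), gammaWeight (k + 1) l u * F u := by
  have h1 : ∀ t ∈ Ioi (0 : ℝ),
      ∫⁻ s in Ioi (0 : ℝ), gammaWeight 0 l s * gammaWeight k l t * F (s + t) =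
      ∫⁻ u in Ioi (0 : ℝ), (Ioi t).indicator
        (fun u => ENNReal.ofReal (t ^ k / k.factorial) * (gammaWeight 0 l u * F u)) u := by
    intro t ht
    rw [mem_Ioi] at ht
    rw [setLIntegral_indicator measurableSet_Ioi, Ioi_inter_Ioi, sup_eq_left.2 ht.le,
      ← lintegral_indicator measurableSet_Ioi, ← lintegral_indicator measurableSet_Ioi]
    symm
    rw [← lintegral_add_right_eq_self _ t]
    symm
    congr 1
    ext s
    by_cases hs : 0 < s
    · rw [indicator_of_mem (by simpa using hs), indicator_of_mem (by simpa using hs), ← mul_assoc]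
      congr 1
      unfold gammaWeight
      rw [← ENNReal.ofReal_mul (by positivity), ← ENNReal.ofReal_mul (by positivity)]
      congr 1
      rw [mul_add, neg_add, Real.exp_add]
      simp
      ring
    · rw [indicator_of_notMem (by simpa using hs), indicator_of_notMem (by simpa using hs)]
  rw [setLIntegral_congr_fun measurableSet_Ioi h1, lintegral_lintegral_swap]
  · refine setLIntegral_congr_fun measurableSet_Ioi fun u hu => ?_
    rw [mem_Ioi] at hu
    have h2 : ∀ t, (Ioi t).indicator (fun u => ENNReal.ofReal (t ^ k / k.factorial) *
        (gammaWeight 0 l u * F u)) u = (Iio u).indicator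
          (fun t => ENNReal.ofReal (t ^ k / k.factorial) * (gammaWeight 0 l u * F u)) t := by
      intro t
      simp only [indicator, mem_Ioi, mem_Iio]
    simp_rw [h2]
    rw [setLIntegral_indicator measurableSet_Iio, lintegral_mul_const _ (by fun_prop),
      inter_comm, Ioi_inter_Iio, ← mul_assoc]
    congr 1
    have h3 : ∫⁻ t in Ioo 0 u, ENNReal.ofReal (t ^ k / k.factorial) =
        ENNReal.ofReal (u ^ (k + 1) / (k + 1).factorial) := by
      rw [← ofReal_integral_eq_lintegral_ofReal, ← integral_Ioc_eq_integral_Ioo,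
        ← intervalIntegral.integral_of_le hu.le]
      · congr 1
        rw [intervalIntegral.integral_div, integral_pow]
        simp [Nat.factorial_succ]
        field_simp
      · exact ((by fun_prop : Continuous fun t : ℝ => t ^ k / k.factorial).integrableOn_Icc).mono_set
          Ioo_subset_Icc_self
      · refine (ae_restrict_iff' measurableSet_Ioo).2 (Filter.Eventually.of_forall fun t ht => ?_)
        have := ht.1
        simp only [Pi.zero_apply]
        positivity
    rw [h3]
    unfold gammaWeight
    rw [← ENNReal.ofReal_mul (by positivity)]
    congr 1
    simp
    ring
  · refine Measurable.aemeasurable ?_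
    have : (Function.uncurry fun t u => (Ioi t).indicator (fun u =>
        ENNReal.ofReal (t ^ k / k.factorial) * (gammaWeight 0 l u * F u)) u) =
        {p : ℝ × ℝ | p.1 < p.2}.indicator fun p =>
          ENNReal.ofReal (p.1 ^ k / k.factorial) * (gammaWeight 0 l p.2 * F p.2) := by
      ext p
      simp [Function.uncurry, indicator]
    rw [this]
    exact Measurable.indicator (by fun_prop) (measurableSet_lt measurable_fst measurable_snd)

/-- The gamma mixtures of a convolution semigroup form a convolution semigroup. -/
theorem lintegral_gammaMix_mul_gammaMix {α : Type*} [MeasurableSpace α] {μ : Measure α}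
    [SFinite μ] (k : ℕ) (l : ℝ) {p q : ℝ → α → ℝ≥0∞} {r : ℝ → ℝ≥0∞}
    (hp : Measurable (Function.uncurry p)) (hq : Measurable (Function.uncurry q))
    (hr : Measurable r)
    (h : ∀ s t, 0 < s → 0 < t → ∫⁻ x, p s x * q t x ∂μ = r (s + t)) :
    ∫⁻ x, (∫⁻ s in Ioi (0 : ℝ), gammaWeight 0 l s * p s x) *
      (∫⁻ t in Ioi (0 : ℝ), gammaWeight k l t * q t x) ∂μ =
      ∫⁻ u in Ioi (0 : ℝ), gammaWeight (k + 1) l u * r u := by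
  rw [← lintegral_Ioi_gammaWeight_add k l hr]
  have hp' : ∀ x, Measurable fun s => p s x := fun x => hp.comp measurable_prodMk_right
  have hq' : ∀ x, Measurable fun s => q s x := fun x => hq.comp measurable_prodMk_right
  have hpx : ∀ s, Measurable fun x => p s x := fun x => hp.comp measurable_prodMk_left
  have hqx : ∀ s, Measurable fun x => q s x := fun x => hq.comp measurable_prodMk_left
  have e : ∀ x, (∫⁻ s in Ioi (0 : ℝ), gammaWeight 0 l s * p s x) *
      (∫⁻ t in Ioi (0 : ℝ), gammaWeight k l t * q t x) =
      ∫⁻ t in Ioi (0 : ℝ), ∫⁻ s in Ioi (0 : ℝ),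
        gammaWeight 0 l s * p s x * (gammaWeight k l t * q t x) := by
    intro x
    have := hp' x
    have := hq' x
    refine (lintegral_const_mul (∫⁻ s in Ioi (0 : ℝ), gammaWeight 0 l s * p s x)
      (f := fun t => gammaWeight k l t * q t x) (by fun_prop)).symm.trans ?_
    congr 1
    ext t
    exact (lintegral_mul_const _ (by fun_prop)).symm
  simp_rw [e]
  rw [lintegral_lintegral_swap]
  · refine setLIntegral_congr_fun measurableSet_Ioi fun t ht => ?_
    rw [lintegral_lintegral_swap]
    · refine setLIntegral_congr_fun measurableSet_Ioi fun s hs => ?_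
      have := hpx s
      have := hqx t
      rw [← h s t hs ht, ← lintegral_const_mul _ (by fun_prop)]
      congr 1
      ext x
      ring
    · have h1 : Measurable fun z : α × ℝ => p z.2 z.1 := hp.comp measurable_swap
      have := hqx t
      exact Measurable.aemeasurable (by unfold Function.uncurry; fun_prop)
  · refine Measurable.aemeasurable ?_
    refine Measurable.lintegral_prod_right' (f := fun z : (α × ℝ) × ℝ =>
      gammaWeight 0 l z.2 * p z.2 z.1.1 * (gammaWeight k l z.1.2 * q z.1.2 z.1.1)) ?_
    have h1 : Measurable fun z : (α × ℝ) × ℝ => p z.2 z.1.1 :=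
      hp.comp (by fun_prop : Measurable fun z : (α × ℝ) × ℝ => (z.2, z.1.1))
    have h2 : Measurable fun z : (α × ℝ) × ℝ => q z.1.2 z.1.1 :=
      hq.comp (by fun_prop : Measurable fun z : (α × ℝ) × ℝ => (z.1.2, z.1.1))
    fun_prop

theorem lintegral_bessel_mul_bessel (k : ℕ) (l y : ℝ) :
    ∫⁻ x, bessel 0 l x * bessel k l (y + x) = bessel (k + 1) l y := by
  refine lintegral_gammaMix_mul_gammaMix k l (p := heat) (q := fun t x => heat t (y + x))
    (r := fun t => heat t y) ?_ ?_ (by fun_prop) fun s t hs ht => lintegral_heat_mul_heat hs ht y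
  · exact measurable_heat
  · unfold Function.uncurry; fun_prop

/-! ### Laplace densities and pairs of opposite signs -/

/-- The Cauchy–Schlömilch transformation of the Gaussian integral. -/
theorem lintegral_exp_neg_sq_cauchySchlomilch {a b : ℝ} (ha : 0 < a) (hb : 0 < b) :
    ∫⁻ u in Ioi (0 : ℝ), ENNReal.ofReal (Real.exp (-(b * u - a / u) ^ 2)) =
      ENNReal.ofReal (√Real.pi / (2 * b)) := by
  set I := ∫⁻ u in Ioi (0 : ℝ), ENNReal.ofReal (Real.exp (-(b * u - a / u) ^ 2)) with hI
  have h1 : ∫⁻ y : ℝ, ENNReal.ofReal (Real.exp (-y ^ 2)) = ENNReal.ofReal √Real.pi := by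
    simpa using lintegral_exp_neg_mul_sq one_pos
  have himg : (fun u : ℝ => b * u - a / u) '' Ioi 0 = univ := by
    refine eq_univ_of_forall fun y => ?_
    have hs : |y| < √(y ^ 2 + 4 * a * b) := by
      rw [← Real.sqrt_sq_eq_abs]
      exact Real.sqrt_lt_sqrt (sq_nonneg y) (by nlinarith [mul_pos ha hb])
    have hq : 0 < y + √(y ^ 2 + 4 * a * b) := by linarith [neg_abs_le y]
    have hsq : √(y ^ 2 + 4 * a * b) ^ 2 = y ^ 2 + 4 * a * b := Real.sq_sqrt (by positivity)
    -- The positive root of `b u² - y u - a = 0`.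
    refine ⟨(y + √(y ^ 2 + 4 * a * b)) / (2 * b), div_pos hq (by positivity), ?_⟩
    generalize √(y ^ 2 + 4 * a * b) = r at *
    simp only
    field_simp
    linear_combination hsq
  have hinj : InjOn (fun u : ℝ => b * u - a / u) (Ioi 0) := by
    intro u hu v hv h
    rw [mem_Ioi] at hu hv
    simp only at h
    field_simp at h
    have : (u - v) * (b * (u * v) + a) = 0 := by linarith
    rcases mul_eq_zero.1 this with h | h
    · linarith
    · nlinarith [mul_pos hb (mul_pos hu hv)]
  have h2 := lintegral_image_eq_lintegral_abs_deriv_mul (s := Ioi (0 : ℝ))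
    (f := fun u => b * u - a / u) (f' := fun u => b + a / u ^ 2) measurableSet_Ioi
    (fun u hu => by
      have hu' : u ≠ 0 := (mem_Ioi.1 hu).ne'
      have h := ((hasDerivAt_id' u).const_mul b).sub ((hasDerivAt_inv hu').const_mul a)
      refine HasDerivAt.hasDerivWithinAt ?_
      convert h using 1
      · ext v
        simp [div_eq_mul_inv]
      · ring) hinj (fun y => ENNReal.ofReal (Real.exp (-y ^ 2)))
  -- The inversion `u ↦ a / (b u)` only changes the sign of `b u - a / u`, and it exchanges the
  -- contributions of the two terms of the Jacobian `b + a / u²`. Each is thus half of the Gaussian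
  -- integral.
  have h3 := lintegral_image_eq_lintegral_abs_deriv_mul (s := Ioi (0 : ℝ))
    (f := fun u => a / b * u⁻¹) (f' := fun u => a / b * -(u ^ 2)⁻¹) measurableSet_Ioi
    (fun u hu => by
      have hu' : u ≠ 0 := (mem_Ioi.1 hu).ne'
      exact ((hasDerivAt_inv hu').const_mul (a / b)).hasDerivWithinAt)
    (fun u hu v hv h => by
      simpa [ha.ne', hb.ne'] using h)
    (fun u => ENNReal.ofReal (Real.exp (-(b * u - a / u) ^ 2)))
  have himg2 : (fun u : ℝ => a / b * u⁻¹) '' Ioi 0 = Ioi 0 := by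
    ext v
    constructor
    · rintro ⟨u, hu, rfl⟩
      rw [mem_Ioi] at hu ⊢
      positivity
    · intro hv
      rw [mem_Ioi] at hv
      refine ⟨a / (b * v), mem_Ioi.2 (by positivity), ?_⟩
      field_simp
  rw [himg, setLIntegral_univ, h1] at h2
  rw [himg2, ← hI] at h3
  have h4 : ENNReal.ofReal √Real.pi = ENNReal.ofReal b * I + ENNReal.ofReal b * I := by
    nth_rewrite 2 [h3]
    rw [h2, hI, ← lintegral_const_mul _ (by fun_prop), ← lintegral_const_mul _ (by fun_prop),
      ← lintegral_add_left (by fun_prop)]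
    refine setLIntegral_congr_fun measurableSet_Ioi fun u hu => ?_
    rw [mem_Ioi] at hu
    have e1 : |b + a / u ^ 2| = b + a / u ^ 2 := abs_of_pos (by positivity)
    have e2 : |a / b * -(u ^ 2)⁻¹| = a / b * (u ^ 2)⁻¹ := by
      rw [mul_neg, abs_neg, abs_of_pos (by positivity)]
    have e3 : b * (a / b * u⁻¹) - a / (a / b * u⁻¹) = -(b * u - a / u) := by
      field_simp; ring
    simp only [e1, e2, e3]
    rw [neg_sq, ← mul_assoc, ← ENNReal.ofReal_mul (q := a / b * _) hb.le, ← add_mul,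
      ← ENNReal.ofReal_add hb.le (by positivity)]
    congr 2
    field_simp
  have h5 : ENNReal.ofReal √Real.pi = ENNReal.ofReal (2 * b) * I := by
    rw [h4, ← add_mul, ← ENNReal.ofReal_add hb.le hb.le, two_mul]
  rw [ENNReal.ofReal_div_of_pos (by positivity), 
    ENNReal.eq_div_iff (by simpa using hb) ENNReal.ofReal_ne_top, h5]

/-- With `t = u²` the exponent `l u² + x² / (16 u²)` is `(√l u - |x| / (4u))² + √l |x| / 2`, to
which the Cauchy–Schlömilch formula applies. -/
theorem bessel_zero_eq {l x : ℝ} (hl : 0 < l) (hx : x ≠ 0) :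
    bessel 0 l x = ENNReal.ofReal (Real.exp (-(√l * |x| / 2)) / (4 * √l)) := by
  have hpi := Real.pi_pos
  have himg : (fun u : ℝ => u ^ 2) '' Ioi 0 = Ioi 0 := by
    ext v
    constructor
    · rintro ⟨u, hu, rfl⟩
      rw [mem_Ioi] at hu ⊢
      positivity
    · intro hv
      rw [mem_Ioi] at hv
      exact ⟨√v, mem_Ioi.2 (by positivity), Real.sq_sqrt hv.le⟩
  have h := lintegral_image_eq_lintegral_abs_deriv_mul (s := Ioi (0 : ℝ))
    (f := fun u => u ^ 2) (f' := fun u => 2 * u) measurableSet_Ioi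
    (fun u _ => by simpa using (hasDerivAt_pow 2 u).hasDerivWithinAt)
    (fun u hu v hv h => by
      rw [mem_Ioi] at hu hv
      exact (pow_left_inj₀ hu.le hv.le two_ne_zero).1 h)
    (fun t => gammaWeight 0 l t * heat t x)
  rw [himg] at h
  rw [bessel, h]
  have e : ∀ u ∈ Ioi (0 : ℝ), ENNReal.ofReal |2 * u| * (gammaWeight 0 l (u ^ 2) * heat (u ^ 2) x) =
      ENNReal.ofReal (Real.exp (-(√l * |x| / 2)) / (2 * √Real.pi)) *
        ENNReal.ofReal (Real.exp (-(√l * u - |x| / 4 / u) ^ 2)) := by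
    intro u hu
    rw [mem_Ioi] at hu
    unfold gammaWeight heat
    rw [← ENNReal.ofReal_mul (by positivity), ← ENNReal.ofReal_mul (by positivity),
      ← ENNReal.ofReal_mul (by positivity)]
    congr 1
    have e1 : √(16 * Real.pi * u ^ 2) = 4 * √Real.pi * u := by
      rw [show 16 * Real.pi * u ^ 2 = Real.pi * (4 * u) ^ 2 by ring,
        Real.sqrt_mul hpi.le, Real.sqrt_sq (by positivity)]
      ring
    have e2 : Real.exp (-(l * u ^ 2)) * Real.exp (-(x ^ 2 / (16 * u ^ 2))) =
        Real.exp (-(√l * |x| / 2)) * Real.exp (-(√l * u - |x| / 4 / u) ^ 2) := by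
      rw [← Real.exp_add, ← Real.exp_add]
      congr 1
      have h1 : √l ^ 2 = l := Real.sq_sqrt hl.le
      have h2 := sq_abs x
      field_simp
      rw [← h2]
      nth_rewrite 1 [← h1]
      ring
    rw [abs_of_pos (by positivity), e1]
    calc _ = (2 * u * (4 * √Real.pi * u)⁻¹) *
          (Real.exp (-(l * u ^ 2)) * Real.exp (-(x ^ 2 / (16 * u ^ 2)))) := by
            simp; ring
      _ = _ := by
        rw [e2]
        field_simp
        ring
  rw [setLIntegral_congr_fun measurableSet_Ioi e, lintegral_const_mul _ (by fun_prop),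
    lintegral_exp_neg_sq_cauchySchlomilch (by positivity) (by positivity),
    ← ENNReal.ofReal_mul (by positivity)]
  congr 1
  field_simp
  ring

theorem lintegral_rpow_mul_exp_neg {a l : ℝ} (ha : 0 < a) (hl : 0 < l) :
    ∫⁻ t in Ioi (0 : ℝ), ENNReal.ofReal (t ^ (a - 1) * Real.exp (-(l * t))) =
      ENNReal.ofReal ((1 / l) ^ a * Real.Gamma a) := by
  rw [← Real.integral_rpow_mul_exp_neg_mul_Ioi ha hl, ofReal_integral_eq_lintegral_ofReal]
  -- A non-integrable function would have Bochner integral zero, but the known value is positive.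
  · by_contra h
    have := Real.integral_rpow_mul_exp_neg_mul_Ioi ha hl
    rw [integral_undef h] at this
    have := mul_pos (Real.rpow_pos_of_pos (one_div_pos.2 hl) a) (Real.Gamma_pos_of_pos ha)
    linarith
  · refine (ae_restrict_iff' measurableSet_Ioi).2 (Filter.Eventually.of_forall fun t ht => ?_)
    rw [mem_Ioi] at ht
    simp only [Pi.zero_apply]
    positivity

theorem lintegral_exp_neg_mul_Ioi {c : ℝ} (hc : 0 < c) (a : ℝ) :
    ∫⁻ x in Ioi a, ENNReal.ofReal (Real.exp (-c * x)) =
      ENNReal.ofReal (Real.exp (-c * a) / c) := by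
  rw [← ofReal_integral_eq_lintegral_ofReal (integrableOn_exp_mul_Ioi (by linarith) a)
    (Filter.Eventually.of_forall fun x => (Real.exp_pos _).le), integral_exp_mul_Ioi (by linarith)]
  congr 1
  rw [neg_div_neg_eq]

/-- Two independent Laplace variables, restricted to the event that their signs differ, have half
the sum distribution of a single one. -/
theorem lintegral_bessel_opposite {l z : ℝ} (hl : 0 < l) (hz : z ≠ 0) :
    ∫⁻ x, {x : ℝ | x * (z - x) < 0}.indicator (fun x => bessel 0 l x * bessel 0 l (z - x)) x =
      ENNReal.ofReal (1 / (2 * l)) * bessel 0 l z := by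
  have hsl : √l ^ 2 = l := Real.sq_sqrt hl.le
  have hset : {x : ℝ | x * (z - x) < 0} = Iio (min 0 z) ∪ Ioi (max 0 z) := by
    ext x
    simp only [mem_ofPred_eq, mul_neg_iff, mem_union, mem_Iio, mem_Ioi, lt_min_iff, max_lt_iff]
    constructor
    · rintro (⟨h, h'⟩ | ⟨h, h'⟩)
      · exact Or.inr ⟨h, by linarith⟩
      · exact Or.inl ⟨h, by linarith⟩
    · rintro (⟨h, h'⟩ | ⟨h, h'⟩)
      · exact Or.inr ⟨h, by linarith⟩
      · exact Or.inl ⟨h, by linarith⟩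
  have hmeas : MeasurableSet (Iio (min 0 z) ∪ Ioi (max 0 z)) := by measurability
  have hdisj : Disjoint (Iio (min 0 z)) (Ioi (max 0 z)) := by
    rw [Set.disjoint_left]
    intro x hx hx'
    rw [mem_Iio, lt_min_iff] at hx
    rw [mem_Ioi, max_lt_iff] at hx'
    linarith [hx.1, hx'.1]
  -- On this half-line the signs of `x` and `w - x` are fixed, so the product is a pure exponential
  -- in `x`. Reflection turns the other half-line into this one, so each contributes `1 / (4l)`.
  have hright : ∀ w : ℝ, w ≠ 0 → ∫⁻ x in Ioi (max 0 w), bessel 0 l x * bessel 0 l (w - x) =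
      ENNReal.ofReal (1 / (4 * l)) * bessel 0 l w := by
    intro w hw
    have e : ∀ x ∈ Ioi (max 0 w), bessel 0 l x * bessel 0 l (w - x) =
        ENNReal.ofReal (Real.exp (√l * w / 2) / (16 * l)) *
          ENNReal.ofReal (Real.exp (-√l * x)) := by
      intro x hx
      rw [mem_Ioi, max_lt_iff] at hx
      rw [bessel_zero_eq hl hx.1.ne', bessel_zero_eq hl (by linarith : w - x < 0).ne,
        abs_of_pos hx.1, abs_of_neg (by linarith), ← ENNReal.ofReal_mul (by positivity),
        ← ENNReal.ofReal_mul (by positivity)]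
      congr 1
      rw [div_mul_div_comm, ← Real.exp_add, div_mul_eq_mul_div, ← Real.exp_add]
      congr 1
      · congr 1; ring
      · nlinarith
    rw [setLIntegral_congr_fun measurableSet_Ioi e, lintegral_const_mul _ (by fun_prop),
      lintegral_exp_neg_mul_Ioi (by positivity), bessel_zero_eq hl hw,
      ← ENNReal.ofReal_mul (by positivity), ← ENNReal.ofReal_mul (by positivity)]
    congr 1
    have e1 : Real.exp (√l * w / 2) * Real.exp (-√l * max 0 w) = Real.exp (-(√l * |w| / 2)) := by
      rw [← Real.exp_add]
      congr 1
      rcases le_total 0 w with h | h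
      · rw [max_eq_right h, abs_of_nonneg h]; ring
      · rw [max_eq_left h, abs_of_nonpos h]; ring
    rw [← e1]
    field_simp
    ring
  have hleft : ∫⁻ x in Iio (min 0 z), bessel 0 l x * bessel 0 l (z - x) =
      ENNReal.ofReal (1 / (4 * l)) * bessel 0 l z := by
    rw [← bessel_neg 0 l z, ← hright (-z) (by simpa using hz), ← lintegral_indicator measurableSet_Iio,
      ← lintegral_indicator measurableSet_Ioi]
    symm
    rw [← lintegral_neg_eq_self]
    symm
    congr 1
    ext x
    by_cases hx : x < min 0 z
    · rw [indicator_of_mem (mem_Iio.2 hx), indicator_of_mem]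
      · rw [← bessel_neg 0 l x, ← bessel_neg 0 l (z - x)]
        congr 2
        ring
      · simp only [mem_Ioi, max_lt_iff]
        simp only [lt_min_iff] at hx
        constructor <;> linarith
    · rw [indicator_of_notMem (mt mem_Iio.1 hx), indicator_of_notMem]
      simp only [mem_Ioi, max_lt_iff]
      simp only [lt_min_iff] at hx
      intro h
      exact hx ⟨by linarith, by linarith⟩
  rw [hset, lintegral_indicator hmeas, lintegral_union measurableSet_Ioi hdisj, hleft, hright z hz,
    ← add_mul, ← ENNReal.ofReal_add (by positivity) (by positivity)]
  congr 2
  field_simp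
  norm_num

/-- Substituting `z = x + y` reduces this to the restricted convolution; the exceptional `z = 0` is
a null set. -/
theorem lintegral_lintegral_bessel_opposite {l : ℝ} (hl : 0 < l) {H : ℝ → ℝ≥0∞}
    (hH : Measurable H) :
    ∫⁻ x, ∫⁻ y, {p : ℝ × ℝ | p.1 * p.2 < 0}.indicator
        (fun p => bessel 0 l p.1 * bessel 0 l p.2 * H (p.1 + p.2)) (x, y) =
      ENNReal.ofReal (1 / (2 * l)) * ∫⁻ z, bessel 0 l z * H z := by
  have hset : MeasurableSet {p : ℝ × ℝ | p.1 * (p.2 - p.1) < 0} :=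
    measurableSet_lt (by fun_prop) (by fun_prop)
  have h1 : ∀ x : ℝ, ∫⁻ y, {p : ℝ × ℝ | p.1 * p.2 < 0}.indicator
        (fun p => bessel 0 l p.1 * bessel 0 l p.2 * H (p.1 + p.2)) (x, y) =
      ∫⁻ z, {p : ℝ × ℝ | p.1 * (p.2 - p.1) < 0}.indicator
        (fun p => bessel 0 l p.1 * bessel 0 l (p.2 - p.1) * H p.2) (x, z) := by
    intro x
    rw [← lintegral_sub_right_eq_self _ x]
    congr 1
    ext z
    simp [indicator]
  simp_rw [h1]
  rw [lintegral_lintegral_swap]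
  · rw [← lintegral_const_mul _ (by fun_prop)]
    refine lintegral_congr_ae ?_
    have : ∀ᵐ z : ℝ, z ≠ 0 := by simp [ae_iff]
    filter_upwards [this] with z hz
    rw [← mul_assoc, ← lintegral_bessel_opposite hl hz, ← lintegral_mul_const]
    · congr 1
      ext x
      simp only [indicator, mem_ofPred_eq, ite_mul, zero_mul]
    · refine Measurable.indicator (by fun_prop) (measurableSet_lt (by fun_prop) (by fun_prop))
  · refine Measurable.aemeasurable ?_
    exact Measurable.indicator (by fun_prop) hset

theorem bessel_apply_zero (k : ℕ) {l : ℝ} (hl : 0 < l) :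
    bessel k l 0 = ENNReal.ofReal ((√(16 * Real.pi))⁻¹ / k.factorial *
      ((1 / l) ^ (k + 1 / 2 : ℝ) * Real.Gamma (k + 1 / 2))) := by
  have hpi := Real.pi_pos
  rw [bessel, ENNReal.ofReal_mul (by positivity),
    ← lintegral_rpow_mul_exp_neg (by positivity) hl, ← lintegral_const_mul _ (by fun_prop)]
  refine setLIntegral_congr_fun measurableSet_Ioi fun t ht => ?_
  rw [mem_Ioi] at ht
  unfold gammaWeight heat
  rw [← ENNReal.ofReal_mul (by positivity), ← ENNReal.ofReal_mul (by positivity)]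
  congr 1
  have e : t ^ ((k : ℝ) + 1 / 2 - 1) = t ^ k * (√t)⁻¹ := by
    rw [show (k : ℝ) + 1 / 2 - 1 = k + -(1 / 2) by ring, Real.rpow_add ht, Real.rpow_natCast,
      Real.rpow_neg ht.le, ← Real.sqrt_eq_rpow]
  rw [e, Real.sqrt_mul (by positivity)]
  simp
  field_simp

/-! ### Gamma mixtures of Gaussians on `ℝ³` -/

/-- Three-dimensional Euclidean space. -/
abbrev E3 : Type := EuclideanSpace ℝ (Fin 3)

/-- The indicator of two reals having opposite signs. -/
def opposite (x y : ℝ) : ℝ≥0∞ := {p : ℝ × ℝ | p.1 * p.2 < 0}.indicator 1 (x, y)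

theorem measurable_opposite : Measurable fun p : ℝ × ℝ => opposite p.1 p.2 :=
  measurable_one.indicator (measurableSet_lt (by fun_prop) (by fun_prop))

@[fun_prop]
theorem Measurable.opposite {α : Type*} [MeasurableSpace α] {f g : α → ℝ} (hf : Measurable f)
    (hg : Measurable g) : Measurable fun a => opposite (f a) (g a) :=
  measurable_opposite.comp (hf.prodMk hg)

/-- The Gaussian density on `ℝ³` with covariance `8 t`. -/
def heatE (t : ℝ) (v : E3) : ℝ≥0∞ := ∏ k, heat t (v k)

/-- The gamma mixture of centred Gaussian densities on `ℝ³`. -/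
def besselE (k : ℕ) (v : E3) : ℝ≥0∞ := ∫⁻ t in Ioi (0 : ℝ), gammaWeight k 1 t * heatE t v

@[fun_prop]
theorem measurable_heatE : Measurable fun p : ℝ × E3 => heatE p.1 p.2 := by
  unfold heatE; fun_prop

@[fun_prop]
theorem Measurable.heatE {α : Type*} [MeasurableSpace α] {f : α → ℝ} {g : α → E3}
    (hf : Measurable f) (hg : Measurable g) : Measurable fun a => heatE (f a) (g a) :=
  measurable_heatE.comp (hf.prodMk hg)

@[fun_prop]
theorem measurable_besselE (k : ℕ) : Measurable (besselE k) := by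
  unfold besselE
  apply Measurable.lintegral_prod_right'
    (f := fun p : E3 × ℝ => gammaWeight k 1 p.2 * heatE p.2 p.1)
  fun_prop

theorem lintegral_fin_prod_eq_prod {n : ℕ} {E : Type*} [MeasurableSpace E]
    {μ : Fin n → Measure E} [∀ i, SigmaFinite (μ i)] {f : Fin n → E → ℝ≥0∞}
    (hf : ∀ i, Measurable (f i)) :
    ∫⁻ x, ∏ i, f i (x i) ∂(Measure.pi μ) = ∏ i, ∫⁻ x, f i x ∂(μ i) := by
  induction n with
  | zero => simp
  | succ n ih =>
    have h := (measurePreserving_piFinSuccAbove μ 0).symm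
    rw [← h.lintegral_comp (by fun_prop)]
    simp_rw [MeasurableEquiv.piFinSuccAbove_symm_apply, Fin.insertNthEquiv, Fin.prod_univ_succ,
      Equiv.coe_fn_mk, Fin.insertNth_zero, Fin.cons_zero, Fin.cons_succ]
    rw [← ih fun i => hf i.succ]
    exact lintegral_prod_mul (μ := μ 0) (ν := Measure.pi fun j => μ j.succ) (g := fun x : Fin n → E => ∏ i, f i.succ (x i)) (hf 0).aemeasurable
      (Measurable.aemeasurable (by fun_prop))

theorem lintegral_E3_prod {f : Fin 3 → ℝ → ℝ≥0∞} (hf : ∀ k, Measurable (f k)) :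
    ∫⁻ v : E3, ∏ k, f k (v k) = ∏ k, ∫⁻ x, f k x := by
  rw [← (PiLp.volume_preserving_toLp (Fin 3)).lintegral_comp (by fun_prop)]
  exact lintegral_fin_prod_eq_prod hf

theorem lintegral_heatE {t : ℝ} (ht : 0 < t) : ∫⁻ v, heatE t v = 1 := by
  unfold heatE
  rw [lintegral_E3_prod (f := fun _ => heat t) (fun _ => by fun_prop)]
  simp [lintegral_heat ht]

theorem lintegral_heatE_mul_heatE {s t : ℝ} (hs : 0 < s) (ht : 0 < t) (y : E3) :
    ∫⁻ x, heatE s x * heatE t (y + x) = heatE (s + t) y := by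
  unfold heatE
  simp_rw [← Finset.prod_mul_distrib, PiLp.add_apply]
  rw [lintegral_E3_prod (f := fun k x => heat s x * heat t (y k + x)) (fun _ => by fun_prop)]
  simp_rw [lintegral_heat_mul_heat hs ht]

theorem lintegral_besselE_mul_besselE (k : ℕ) (y : E3) :
    ∫⁻ x, besselE 0 x * besselE k (y + x) = besselE (k + 1) y := by
  refine lintegral_gammaMix_mul_gammaMix k 1 (p := heatE) (q := fun t x => heatE t (y + x))
    (r := fun t => heatE t y) ?_ ?_ (by fun_prop) fun s t hs ht => lintegral_heatE_mul_heatE hs ht y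
  · exact measurable_heatE
  · unfold Function.uncurry; fun_prop

theorem heatE_eq {t : ℝ} (ht : 0 < t) (v : E3) : heatE t v =
    ENNReal.ofReal (((√(16 * Real.pi * t))⁻¹) ^ 3 * Real.exp (-(‖v‖ ^ 2 / (16 * t)))) := by
  have hpi := Real.pi_pos
  unfold heatE heat
  rw [← ENNReal.ofReal_prod_of_nonneg (fun k _ => by positivity), Finset.prod_mul_distrib,
    ← Real.exp_sum, EuclideanSpace.real_norm_sq_eq, Finset.sum_neg_distrib, Finset.sum_div]
  simp

theorem heatE_congr_norm {v w : E3} (h : ‖v‖ = ‖w‖) {t : ℝ} (ht : 0 < t) :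
    heatE t v = heatE t w := by
  rw [heatE_eq ht, heatE_eq ht, h]

theorem besselE_congr_norm {v w : E3} (h : ‖v‖ = ‖w‖) (k : ℕ) : besselE k v = besselE k w :=
  setLIntegral_congr_fun measurableSet_Ioi fun t ht => by
    simp only [heatE_congr_norm h (mem_Ioi.1 ht)]

/-- This value is the total mass of the unnormalized density of two edges
(`lintegral_besselE_three`), so it is the denominator of the final ratio. -/
theorem besselE_add_two_apply_zero (m : ℕ) : besselE (m + 2) 0 =
    ENNReal.ofReal (((√(16 * Real.pi))⁻¹) ^ 3 / (m + 2).factorial * Real.Gamma (m + 3 / 2)) := by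
  have hpi := Real.pi_pos
  have h := lintegral_rpow_mul_exp_neg (a := (m : ℝ) + 3 / 2) (l := 1) (by positivity) one_pos
  rw [div_one, Real.one_rpow, one_mul] at h
  rw [besselE, ENNReal.ofReal_mul (by positivity), ← h, ← lintegral_const_mul _ (by fun_prop)]
  refine setLIntegral_congr_fun measurableSet_Ioi fun t ht => ?_
  rw [mem_Ioi] at ht
  simp only [heatE_eq ht]
  unfold gammaWeight
  rw [← ENNReal.ofReal_mul (by positivity), ← ENNReal.ofReal_mul (by positivity)]
  congr 1
  have e : t ^ ((m : ℝ) + 3 / 2 - 1) = t ^ m * √t := by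
    rw [show (m : ℝ) + 3 / 2 - 1 = m + 1 / 2 by ring, Real.rpow_add ht, Real.rpow_natCast,
      ← Real.sqrt_eq_rpow]
  have hs : √t ^ 2 = t := Real.sq_sqrt ht.le
  rw [e, Real.sqrt_mul (by positivity)]
  simp
  field_simp
  rw [show √t ^ 4 = (√t ^ 2) ^ 2 by ring, hs]
  ring

theorem besselE_add_two_apply_zero_ne_zero (m : ℕ) : besselE (m + 2) 0 ≠ 0 := by
  have hpi := Real.pi_pos
  have := Real.Gamma_pos_of_pos (by positivity : (0 : ℝ) < m + 3 / 2)
  rw [besselE_add_two_apply_zero]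
  simp only [ne_eq, ENNReal.ofReal_eq_zero, not_le]
  positivity

theorem besselE_add_two_apply_zero_ne_top (m : ℕ) : besselE (m + 2) 0 ≠ ∞ := by
  rw [besselE_add_two_apply_zero]
  exact ENNReal.ofReal_ne_top

/-! ### Opposite signs of a coordinate: from `ℝ³` to the line -/

/-- Tonelli brings the three mixing times outside, so that the spatial integrals on `ℝ³` and on `ℝ`
can be compared at fixed times, where the densities are Gaussian. -/
theorem lintegral_mul_gammaMix_three {α : Type*} [MeasurableSpace α] {μ : Measure α}
    [SFinite μ] (m : ℕ) (l : ℝ) {f : α → ℝ≥0∞} {p q r : ℝ → α → ℝ≥0∞} (hf : Measurable f)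
    (hp : Measurable (Function.uncurry p)) (hq : Measurable (Function.uncurry q))
    (hr : Measurable (Function.uncurry r)) :
    ∫⁻ x, f x * ((∫⁻ s in Ioi (0 : ℝ), gammaWeight 0 l s * p s x) *
      ((∫⁻ s in Ioi (0 : ℝ), gammaWeight 0 l s * q s x) *
        ∫⁻ s in Ioi (0 : ℝ), gammaWeight m l s * r s x)) ∂μ =
    ∫⁻ z : ℝ × ℝ × ℝ, gammaWeight 0 l z.1 * gammaWeight 0 l z.2.1 * gammaWeight m l z.2.2 *
      ∫⁻ x, f x * (p z.1 x * (q z.2.1 x * r z.2.2 x)) ∂μ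
      ∂((volume.restrict (Ioi 0)).prod ((volume.restrict (Ioi 0)).prod
        (volume.restrict (Ioi 0)))) := by
  have hp' : ∀ x, Measurable fun s => p s x := fun x => hp.comp measurable_prodMk_right
  have hq' : ∀ x, Measurable fun s => q s x := fun x => hq.comp measurable_prodMk_right
  have hr' : ∀ x, Measurable fun s => r s x := fun x => hr.comp measurable_prodMk_right
  have h1 : Measurable fun z : α × ℝ × ℝ × ℝ => p z.2.1 z.1 :=
    hp.comp (by fun_prop : Measurable fun z : α × ℝ × ℝ × ℝ => (z.2.1, z.1))
  have h2 : Measurable fun z : α × ℝ × ℝ × ℝ => q z.2.2.1 z.1 :=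
    hq.comp (by fun_prop : Measurable fun z : α × ℝ × ℝ × ℝ => (z.2.2.1, z.1))
  have h3 : Measurable fun z : α × ℝ × ℝ × ℝ => r z.2.2.2 z.1 :=
    hr.comp (by fun_prop : Measurable fun z : α × ℝ × ℝ × ℝ => (z.2.2.2, z.1))
  have hF : Measurable fun z : α × ℝ × ℝ × ℝ => f z.1 * ((gammaWeight 0 l z.2.1 * p z.2.1 z.1) *
      ((gammaWeight 0 l z.2.2.1 * q z.2.2.1 z.1) * (gammaWeight m l z.2.2.2 * r z.2.2.2 z.1))) := by
    fun_prop
  have e : ∀ x, f x * ((∫⁻ s in Ioi (0 : ℝ), gammaWeight 0 l s * p s x) *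
      ((∫⁻ s in Ioi (0 : ℝ), gammaWeight 0 l s * q s x) *
        ∫⁻ s in Ioi (0 : ℝ), gammaWeight m l s * r s x)) =
      ∫⁻ z : ℝ × ℝ × ℝ, f x * ((gammaWeight 0 l z.1 * p z.1 x) *
        ((gammaWeight 0 l z.2.1 * q z.2.1 x) * (gammaWeight m l z.2.2 * r z.2.2 x)))
        ∂((volume.restrict (Ioi 0)).prod ((volume.restrict (Ioi 0)).prod
          (volume.restrict (Ioi 0)))) := by
    intro x
    have := hp' x
    have := hq' x
    have := hr' x
    rw [lintegral_const_mul _ (by fun_prop),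
      lintegral_prod_mul (f := fun s => gammaWeight 0 l s * p s x)
        (g := fun z : ℝ × ℝ => (gammaWeight 0 l z.1 * q z.1 x) * (gammaWeight m l z.2 * r z.2 x))
        (Measurable.aemeasurable (by fun_prop)) (Measurable.aemeasurable (by fun_prop)),
      lintegral_prod_mul (f := fun s => gammaWeight 0 l s * q s x)
        (g := fun s => gammaWeight m l s * r s x)
        (Measurable.aemeasurable (by fun_prop)) (Measurable.aemeasurable (by fun_prop))]
  simp_rw [e]
  rw [lintegral_lintegral_swap hF.aemeasurable]
  congr 1
  ext z
  have h1z : Measurable fun x => p z.1 x := hp.comp measurable_prodMk_left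
  have h2z : Measurable fun x => q z.2.1 x := hq.comp measurable_prodMk_left
  have h3z : Measurable fun x => r z.2.2 x := hr.comp measurable_prodMk_left
  rw [← lintegral_const_mul _ (by fun_prop)]
  congr 1
  ext x
  ring

/-- At fixed times the coordinates decouple. The sign condition sees only coordinate `0`; in each of
the other two, the semigroup law gives `heat (r + s + t) 0`. -/
theorem lintegral_opposite_heatE {r s t : ℝ} (hr : 0 < r) (hs : 0 < s) (ht : 0 < t) :
    ∫⁻ z : E3 × E3, opposite (z.1 0) (z.2 0) * (heatE r z.1 * (heatE s z.2 *
      heatE t (z.1 + z.2))) =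
    heat (r + s + t) 0 ^ 2 *
      ∫⁻ z : ℝ × ℝ, opposite z.1 z.2 * (heat r z.1 * (heat s z.2 * heat t (z.1 + z.2))) := by
  set h : Fin 3 → ℝ → ℝ → ℝ≥0∞ := fun k x y => (if k = 0 then opposite x y else 1) *
    (heat r x * (heat s y * heat t (x + y))) with hh
  have hm : ∀ k, Measurable fun p : ℝ × ℝ => h k p.1 p.2 := by
    intro k
    simp only [hh]
    split_ifs <;> fun_prop
  have hm' : ∀ k x, Measurable fun y => h k x y := fun k x => (hm k).comp measurable_prodMk_left
  have hm'' : ∀ k, Measurable fun x => ∫⁻ y, h k x y := fun k =>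
    Measurable.lintegral_prod_right' (hm k)
  have e1 : ∀ x : ℝ, ∫⁻ y, heat r x * (heat s y * heat t (x + y)) =
      heat r x * heat (s + t) (0 + x) := by
    intro x
    rw [lintegral_const_mul _ (by fun_prop), lintegral_heat_mul_heat hs ht, zero_add]
  rw [Measure.volume_eq_prod, lintegral_prod _ (Measurable.aemeasurable (by fun_prop)),
    Measure.volume_eq_prod, lintegral_prod _ (Measurable.aemeasurable (by fun_prop))]
  have e2 : ∀ a b : E3, opposite (a 0) (b 0) * (heatE r a * (heatE s b * heatE t (a + b))) =
      ∏ k, h k (a k) (b k) := by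
    intro a b
    simp only [hh, heatE, Fin.prod_univ_three, PiLp.add_apply]
    simp
    ring
  simp_rw [e2]
  have e3 : ∀ a : E3, ∫⁻ b : E3, ∏ k, h k (a k) (b k) = ∏ k, ∫⁻ y, h k (a k) y := fun a =>
    lintegral_E3_prod fun k => hm' k (a k)
  simp_rw [e3]
  rw [lintegral_E3_prod hm'', Fin.prod_univ_three]
  simp only [hh]
  simp [e1]
  have e4 := lintegral_heat_mul_heat hr (add_pos hs ht) 0
  simp only [zero_add] at e4
  rw [e4, ← add_assoc]
  ring

-- With `T` the total time, the two idle coordinates give `heat T 0 ^ 2 = 1 / (16πT)`. The factor `1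
-- / T` is absorbed by `e^{-T} / T = ∫_1^∞ e^{-lT} dl`, which turns the rate `1` into a variable
-- rate `l`. This works because the mixtures do not couple the times except through `T`.
set_option maxHeartbeats 1000000 in
theorem lintegral_opposite_mul_besselE (m : ℕ) :
    ∫⁻ z : E3 × E3, opposite (z.1 0) (z.2 0) * (besselE 0 z.1 * (besselE 0 z.2 *
      besselE m (z.1 + z.2))) =
    ENNReal.ofReal (1 / (16 * Real.pi)) * ∫⁻ l in Ioi (1 : ℝ),
      ∫⁻ z : ℝ × ℝ, opposite z.1 z.2 * (bessel 0 l z.1 * (bessel 0 l z.2 *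
        bessel m l (z.1 + z.2))) := by
  have hpi := Real.pi_pos
  unfold besselE bessel
  have hl := fun l : ℝ => lintegral_mul_gammaMix_three (μ := (volume : Measure (ℝ × ℝ))) m l
    (f := fun z => opposite z.1 z.2) (p := fun t z => heat t z.1) (q := fun t z => heat t z.2)
    (r := fun t z => heat t (z.1 + z.2)) (by fun_prop) (by unfold Function.uncurry; fun_prop)
    (by unfold Function.uncurry; fun_prop) (by unfold Function.uncurry; fun_prop)
  simp_rw [hl]
  have h1 := lintegral_mul_gammaMix_three (μ := (volume : Measure (E3 × E3))) m 1
    (f := fun z => opposite (z.1 0) (z.2 0)) (p := fun t z => heatE t z.1)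
    (q := fun t z => heatE t z.2)
    (r := fun t z => heatE t (z.1 + z.2)) (by fun_prop) (by unfold Function.uncurry; fun_prop)
    (by unfold Function.uncurry; fun_prop) (by unfold Function.uncurry; fun_prop)
  rw [h1]
  have hQ : Measurable fun z : ℝ × ℝ × ℝ => ∫⁻ x : ℝ × ℝ, opposite x.1 x.2 *
      (heat z.1 x.1 * (heat z.2.1 x.2 * heat z.2.2 (x.1 + x.2))) := by
    apply Measurable.lintegral_prod_right' (f := fun p : (ℝ × ℝ × ℝ) × (ℝ × ℝ) =>
      opposite p.2.1 p.2.2 *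
      (heat p.1.1 p.2.1 * (heat p.1.2.1 p.2.2 * heat p.1.2.2 (p.2.1 + p.2.2))))
    fun_prop
  rw [lintegral_lintegral_swap, ← lintegral_const_mul']
  · have hae : ∀ᵐ z : ℝ × ℝ × ℝ ∂((volume.restrict (Ioi (0 : ℝ))).prod
        ((volume.restrict (Ioi (0 : ℝ))).prod (volume.restrict (Ioi (0 : ℝ))))),
        0 < z.1 ∧ 0 < z.2.1 ∧ 0 < z.2.2 := by
      rw [Measure.prod_restrict, Measure.prod_restrict]
      filter_upwards [ae_restrict_mem (measurableSet_Ioi.prod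
        (measurableSet_Ioi.prod measurableSet_Ioi))] with z hz
      exact ⟨hz.1, hz.2.1, hz.2.2⟩
    refine lintegral_congr_ae ?_
    filter_upwards [hae] with z hz
    obtain ⟨h1, h2, h3⟩ := hz
    rw [lintegral_opposite_heatE h1 h2 h3, lintegral_mul_const _ (by fun_prop), ← mul_assoc, ← mul_assoc]
    congr 1
    set T := z.1 + z.2.1 + z.2.2 with hT
    have hTpos : 0 < T := by positivity
    have e : ∀ l, gammaWeight 0 l z.1 * gammaWeight 0 l z.2.1 * gammaWeight m l z.2.2 =
        ENNReal.ofReal (z.2.2 ^ m / m.factorial) * ENNReal.ofReal (Real.exp (-T * l)) := by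
      intro l
      unfold gammaWeight
      rw [← ENNReal.ofReal_mul (by positivity), ← ENNReal.ofReal_mul (by positivity),
        ← ENNReal.ofReal_mul (by positivity)]
      congr 1
      rw [show -T * l = -(l * z.1) + -(l * z.2.1) + -(l * z.2.2) by rw [hT]; ring,
        Real.exp_add, Real.exp_add]
      simp
      ring
    simp_rw [e]
    rw [lintegral_const_mul _ (by fun_prop), lintegral_exp_neg_mul_Ioi hTpos]
    unfold heat
    rw [← ENNReal.ofReal_pow (by positivity), ← ENNReal.ofReal_mul (by positivity),
      ← ENNReal.ofReal_mul (by positivity), ← ENNReal.ofReal_mul (by positivity),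
      ← ENNReal.ofReal_mul (by positivity)]
    congr 1
    have hs : √(16 * Real.pi * T) ^ 2 = 16 * Real.pi * T := Real.sq_sqrt (by positivity)
    rw [mul_pow, inv_pow, hs]
    simp
    field_simp
  · exact ENNReal.ofReal_ne_top
  · refine Measurable.aemeasurable ?_
    have hQ' := hQ.comp (by fun_prop : Measurable fun p : ℝ × ℝ × ℝ × ℝ => p.2)
    unfold Function.uncurry
    simp only [Function.comp_def] at hQ'
    fun_prop

/-- The pair of opposite signs merges into one Laplace variable at the cost `1 / (2l)`, and the
semigroup law closes the remaining loop. -/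
theorem lintegral_opposite_mul_bessel (m : ℕ) {l : ℝ} (hl : 0 < l) :
    ∫⁻ z : ℝ × ℝ, opposite z.1 z.2 * (bessel 0 l z.1 * (bessel 0 l z.2 *
        bessel m l (z.1 + z.2))) = ENNReal.ofReal (1 / (2 * l)) * bessel (m + 1) l 0 := by
  have h := lintegral_lintegral_bessel_opposite hl (measurable_bessel m l)
  have h' := lintegral_bessel_mul_bessel m l 0
  simp only [zero_add] at h'
  rw [h'] at h
  rw [← h, Measure.volume_eq_prod, lintegral_prod _ (Measurable.aemeasurable (by fun_prop))]
  simp only [opposite, indicator, Pi.one_apply, ite_mul, one_mul, zero_mul, mul_assoc]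

/-- The probability that a given coordinate has opposite signs on two edges of a closed polygon. -/
theorem lintegral_opposite_mul_besselE_eq (m : ℕ) :
    ∫⁻ z : E3 × E3, opposite (z.1 0) (z.2 0) * (besselE 0 z.1 * (besselE 0 z.2 *
      besselE m (z.1 + z.2))) =
    ENNReal.ofReal ((m + 2) / (2 * m + 3)) * besselE (m + 2) 0 := by
  have hpi := Real.pi_pos
  have hG := Real.Gamma_pos_of_pos (by positivity : (0 : ℝ) < m + 3 / 2)
  rw [lintegral_opposite_mul_besselE, besselE_add_two_apply_zero]
  set C : ℝ := (√(16 * Real.pi))⁻¹ / (m + 1).factorial * Real.Gamma (m + 3 / 2) / 2 with hC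
  have hC0 : 0 ≤ C := by positivity
  -- The power of `l` is `l⁻¹` from the sign condition times `l ^ (-(m + 3/2))` from `bessel (m + 1)
  -- l 0`; its integral over `l > 1` is `2 / (2m + 3)`.
  have e : ∀ l ∈ Ioi (1 : ℝ), ∫⁻ z : ℝ × ℝ, opposite z.1 z.2 * (bessel 0 l z.1 * (bessel 0 l z.2 *
        bessel m l (z.1 + z.2))) = ENNReal.ofReal C * ENNReal.ofReal (l ^ (-(m + 5 / 2) : ℝ)) := by
    intro l hl
    have hl' : 0 < l := one_pos.trans hl
    rw [lintegral_opposite_mul_bessel m hl', bessel_apply_zero _ hl', ←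
      ENNReal.ofReal_mul (by positivity), ← ENNReal.ofReal_mul hC0]
    congr 1
    have e1 : ((m + 1 : ℕ) : ℝ) + 1 / 2 = m + 3 / 2 := by push_cast; ring
    have e2 : l ^ (-(m + 5 / 2) : ℝ) = l⁻¹ * (1 / l) ^ (m + 3 / 2 : ℝ) := by
      rw [one_div, Real.inv_rpow hl'.le, ← Real.rpow_neg hl'.le, ← Real.rpow_neg_one,
        ← Real.rpow_add hl']
      congr 1
      ring
    rw [e1, e2, hC]
    field_simp
  rw [setLIntegral_congr_fun measurableSet_Ioi e, lintegral_const_mul _ (by fun_prop),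
    ← ofReal_integral_eq_lintegral_ofReal (integrableOn_Ioi_rpow_of_lt (by linarith) one_pos),
    integral_Ioi_rpow_of_lt (by linarith) one_pos, ← ENNReal.ofReal_mul hC0,
    ← ENNReal.ofReal_mul (by positivity), ← ENNReal.ofReal_mul (by positivity)]
  · congr 1
    have hs : √(16 * Real.pi) ^ 2 = 16 * Real.pi := Real.sq_sqrt (by positivity)
    have hs0 : 0 < √(16 * Real.pi) := by positivity
    have h1 : -(1 : ℝ) / (-(m + 5 / 2) + 1) = 2 / (2 * m + 3) := by
      have : (0 : ℝ) ≤ m := by positivity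
      rw [div_eq_div_iff (by linarith) (by linarith)]
      ring
    rw [Real.one_rpow, h1, hC, Nat.factorial_succ (m + 1),
      show 1 / (16 * Real.pi) = 1 / √(16 * Real.pi) ^ 2 by rw [hs]]
    generalize √(16 * Real.pi) = σ at *
    push_cast
    field_simp
    ring
  · refine (ae_restrict_iff' measurableSet_Ioi).2 (Filter.Eventually.of_forall fun t ht => ?_)
    have : 0 < t := one_pos.trans ht
    simp only [Pi.zero_apply]
    positivity

/-! ### Rotation invariance -/

theorem opposite_mul_left {c : ℝ} (hc : 0 < c) (x y : ℝ) : opposite (c * x) y = opposite x y := by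
  have : c * x * y < 0 ↔ x * y < 0 := by
    rw [mul_assoc]
    exact ⟨fun h => by by_contra h'; nlinarith [mul_nonneg hc.le (not_lt.1 h')],
      fun h => mul_neg_of_pos_of_neg hc h⟩
  simp only [opposite, indicator, mem_ofPred_eq, this, Pi.one_apply]

theorem opposite_comm (x y : ℝ) : opposite x y = opposite y x := by
  simp only [opposite, indicator, mem_ofPred_eq, mul_comm, Pi.one_apply]

theorem opposite_mul_mul {c : ℝ} (hc : 0 < c) (x y : ℝ) :
    opposite (c * x) (c * y) = opposite x y := by
  rw [opposite_mul_left hc, opposite_comm, opposite_mul_left hc, opposite_comm]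

/-- The reflection in the hyperplane orthogonal to `v - w`. The last clause allows one vector to be
moved while another, already in normal position, stays fixed. -/
theorem exists_linearIsometryEquiv_apply_eq {v w : E3} (h : ‖v‖ = ‖w‖) :
    ∃ Q : E3 ≃ₗᵢ[ℝ] E3, Q v = w ∧ ∀ x, inner ℝ x v = inner ℝ x w → Q x = x :=
  ⟨(ℝ ∙ (v - w))ᗮ.reflection, Submodule.reflection_sub h, fun x hx =>
    Submodule.reflection_mem_subspace_eq_self (Submodule.mem_orthogonal_singleton_iff_inner_left.2
      (by rw [inner_sub_right, hx, sub_self]))⟩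

theorem lintegral_opposite_inner_mul_besselE (m : ℕ) {u : E3} (hu : u ≠ 0) :
    ∫⁻ z : E3 × E3, opposite (inner ℝ u z.1) (inner ℝ u z.2) * (besselE 0 z.1 * (besselE 0 z.2 *
      besselE m (z.1 + z.2))) =
    ENNReal.ofReal ((m + 2) / (2 * m + 3)) * besselE (m + 2) 0 := by
  obtain ⟨Q, hQ, -⟩ := exists_linearIsometryEquiv_apply_eq
    (v := EuclideanSpace.single 0 ‖u‖) (w := u) (by simp)
  rw [← lintegral_opposite_mul_besselE_eq, Measure.volume_eq_prod,
    ← (Q.measurePreserving.prod Q.measurePreserving).lintegral_comp (by fun_prop)]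
  congr 1
  ext z
  have h1 : ∀ x : E3, inner ℝ u (Q x) = ‖u‖ * x 0 := by
    intro x
    nth_rewrite 1 [← hQ]
    rw [Q.inner_map_map, EuclideanSpace.inner_single_left]
    simp
  simp only [Prod.map_fst, Prod.map_snd, h1]
  rw [opposite_mul_mul (norm_pos_iff.2 hu), ← map_add]
  rw [besselE_congr_norm (Q.norm_map z.1), besselE_congr_norm (Q.norm_map z.2),
    besselE_congr_norm (Q.norm_map (z.1 + z.2))]

/-! ### The angle as a separation probability -/

theorem lintegral_E3_eq {F : E3 → ℝ≥0∞} (hF : Measurable F) :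
    ∫⁻ v, F v = ∫⁻ x : ℝ, ∫⁻ y : ℝ, ∫⁻ z : ℝ, F !₂[x, y, z] := by
  rw [← (PiLp.volume_preserving_toLp (Fin 3)).lintegral_comp hF,
    ← (volume_preserving_piFinSuccAbove (fun _ : Fin 3 => ℝ) 0).symm.lintegral_comp (by fun_prop),
    Measure.volume_eq_prod, lintegral_prod _ (Measurable.aemeasurable (by fun_prop))]
  congr 1
  ext x
  rw [← (volume_preserving_finTwoArrow ℝ).symm.lintegral_comp (by fun_prop),
    Measure.volume_eq_prod, lintegral_prod _ (Measurable.aemeasurable (by fun_prop))]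
  congr 1
  ext y
  congr 1
  ext z
  congr 2
  ext k
  fin_cases k <;> rfl

theorem lintegral_comp_mul_left {c : ℝ} (hc : c ≠ 0) {f : ℝ → ℝ≥0∞} (hf : Measurable f) :
    ENNReal.ofReal |c| * ∫⁻ w, f (c * w) = ∫⁻ y, f y := by
  nth_rewrite 2 [← Real.smul_map_volume_mul_left hc]
  rw [lintegral_smul_measure, lintegral_map hf (by fun_prop), smul_eq_mul]

theorem lintegral_abs_mul_exp_neg_mul_sq {c : ℝ} (hc : 0 < c) :
    ∫⁻ x : ℝ, ENNReal.ofReal (|x| * Real.exp (-c * x ^ 2)) = ENNReal.ofReal (1 / c) := by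
  have hint : Integrable fun x : ℝ => |x| * Real.exp (-c * x ^ 2) := by
    simpa [abs_mul] using (integrable_mul_exp_neg_mul_sq hc).abs
  rw [← ofReal_integral_eq_lintegral_ofReal hint
    (Filter.Eventually.of_forall fun x => by simp only [Pi.zero_apply]; positivity)]
  congr 1
  have h := integral_comp_abs (f := fun x => x * Real.exp (-c * x ^ 2))
  simp only [sq_abs] at h
  have h2 := integral_rpow_mul_exp_neg_mul_rpow (p := 2) (q := 1) (b := c) two_pos (by norm_num) hc
  simp only [Real.rpow_one, Real.rpow_two] at h2
  rw [h, h2]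
  norm_num
  rw [Real.rpow_neg_one]
  ring

/-- The ratio `w = y / x` of two independent Gaussians is Cauchy distributed, and the sign condition
reads `w < -β / r`. The arctangent in the Cauchy distribution function supplies the angle. -/
theorem lintegral_heat_mul_opposite {β r : ℝ} (hr : 0 < r) :
    ∫⁻ x, ∫⁻ y, heat 1 x * heat 1 y * opposite x (β * x + r * y) =
      ENNReal.ofReal (Real.arccos (β / √(β ^ 2 + r ^ 2)) / Real.pi) := by
  have hpi := Real.pi_pos
  have h1 : ∀ᵐ x : ℝ, ∫⁻ y, heat 1 x * heat 1 y * opposite x (β * x + r * y) =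
      ∫⁻ w, (Iio (-β / r)).indicator (fun w => ENNReal.ofReal |x| * (heat 1 x * heat 1 (x * w))) w := by
    have : ∀ᵐ x : ℝ, x ≠ 0 := by simp [ae_iff]
    filter_upwards [this] with x hx
    rw [← lintegral_comp_mul_left hx (by fun_prop), ← lintegral_const_mul _ (by fun_prop)]
    congr 1
    ext w
    have hiff : x * (β * x + r * (x * w)) < 0 ↔ w < -β / r := by
      rw [lt_div_iff₀ hr, show x * (β * x + r * (x * w)) = x ^ 2 * (β + w * r) by ring]
      have hx2 : 0 < x ^ 2 := by positivity
      constructor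
      · intro h
        by_contra h'
        nlinarith [mul_nonneg hx2.le (by linarith : 0 ≤ β + w * r)]
      · intro h
        exact mul_neg_of_pos_of_neg hx2 (by linarith)
    simp only [opposite, indicator, mem_ofPred_eq, hiff, mem_Iio, Pi.one_apply, mul_ite, mul_one,
      mul_zero]
  rw [lintegral_congr_ae h1, lintegral_lintegral_swap]
  · have h2 : ∀ w, ∫⁻ x, (Iio (-β / r)).indicator
        (fun w => ENNReal.ofReal |x| * (heat 1 x * heat 1 (x * w))) w =
        (Iio (-β / r)).indicator (fun w => ENNReal.ofReal (1 / Real.pi * (1 + w ^ 2)⁻¹)) w := by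
      intro w
      by_cases hw : w ∈ Iio (-β / r)
      · simp only [indicator_of_mem hw]
        have h3 : ∀ x, ENNReal.ofReal |x| * (heat 1 x * heat 1 (x * w)) =
            ENNReal.ofReal (1 / (16 * Real.pi)) *
              ENNReal.ofReal (|x| * Real.exp (-((1 + w ^ 2) / 16) * x ^ 2)) := by
          intro x
          unfold heat
          rw [← ENNReal.ofReal_mul (by positivity), ← ENNReal.ofReal_mul (by positivity),
            ← ENNReal.ofReal_mul (by positivity)]
          congr 1
          have hs : √(16 * Real.pi) ^ 2 = 16 * Real.pi := Real.sq_sqrt (by positivity)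
          rw [show -((1 + w ^ 2) / 16) * x ^ 2 = -(x ^ 2 / (16 * 1)) + -((x * w) ^ 2 / (16 * 1)) by
            ring, Real.exp_add, mul_one, ← hs, Real.sqrt_sq (by positivity)]
          field_simp
        simp_rw [h3]
        rw [lintegral_const_mul _ (by fun_prop), lintegral_abs_mul_exp_neg_mul_sq (by positivity),
          ← ENNReal.ofReal_mul (by positivity)]
        congr 1
        field_simp
      · simp only [indicator_of_notMem hw, lintegral_zero]
    simp_rw [h2]
    rw [lintegral_indicator measurableSet_Iio, setLIntegral_congr Iio_ae_eq_Iic,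
      ← ofReal_integral_eq_lintegral_ofReal
        ((integrable_inv_one_add_sq.const_mul (1 / Real.pi)).integrableOn)
        (Filter.Eventually.of_forall fun x => by simp only [Pi.zero_apply]; positivity),
      integral_const_mul, integral_Iic_inv_one_add_sq]
    congr 1
    have h4 : β / r / √(1 + (β / r) ^ 2) = β / √(β ^ 2 + r ^ 2) := by
      rw [show 1 + (β / r) ^ 2 = (β ^ 2 + r ^ 2) / r ^ 2 by field_simp; ring,
        Real.sqrt_div' _ (by positivity), Real.sqrt_sq hr.le]
      field_simp
    rw [neg_div, Real.arctan_neg, Real.arctan_eq_arcsin, h4, Real.arccos]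
    ring
  · have : Function.uncurry (fun x w => (Iio (-β / r)).indicator
        (fun w => ENNReal.ofReal |x| * (heat 1 x * heat 1 (x * w))) w) =
        (Prod.snd ⁻¹' Iio (-β / r)).indicator fun p : ℝ × ℝ =>
          ENNReal.ofReal |p.1| * (heat 1 p.1 * heat 1 (p.1 * p.2)) := by
      ext p
      simp [Function.uncurry, indicator]
    rw [this]
    exact (Measurable.indicator (by fun_prop) (measurable_snd measurableSet_Iio)).aemeasurable

/-- The degenerate case of parallel vectors, where the angle is `0` or `π` according to the sign of
`β`. -/
theorem lintegral_heat_mul_opposite_self {β : ℝ} (hβ : β ≠ 0) :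
    ∫⁻ x, ∫⁻ y, heat 1 x * heat 1 y * opposite x (β * x) =
      ENNReal.ofReal (Real.arccos (β / √(β ^ 2)) / Real.pi) := by
  rw [Real.sqrt_sq_eq_abs]
  rcases lt_or_gt_of_ne hβ with h | h
  · have h1 : ∀ᵐ x : ℝ, ∫⁻ y, heat 1 x * heat 1 y * opposite x (β * x) = heat 1 x := by
      have : ∀ᵐ x : ℝ, x ≠ 0 := by simp [ae_iff]
      filter_upwards [this] with x hx
      have : x * (β * x) < 0 := by
        rw [show x * (β * x) = x ^ 2 * β by ring]
        exact mul_neg_of_pos_of_neg (by positivity) h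
      simp only [opposite, indicator, mem_ofPred_eq, this, if_true, Pi.one_apply, mul_one]
      rw [lintegral_const_mul _ (by fun_prop), lintegral_heat one_pos, mul_one]
    rw [lintegral_congr_ae h1, lintegral_heat one_pos, abs_of_neg h, div_neg, div_self hβ,
      Real.arccos_neg_one, div_self Real.pi_ne_zero, ENNReal.ofReal_one]
  · have h1 : ∀ x, opposite x (β * x) = 0 := by
      intro x
      have : ¬ x * (β * x) < 0 := by
        rw [show x * (β * x) = x ^ 2 * β by ring, not_lt]
        positivity
      simp only [opposite, indicator, mem_ofPred_eq, this, if_false]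
    simp [h1, abs_of_pos h, div_self hβ]

/-- The probability that a Gaussian random plane separates two vectors is proportional to the angle
between them. -/
theorem lintegral_heatE_mul_opposite_inner {a b : E3} (ha : a ≠ 0) (hb : b ≠ 0) :
    ∫⁻ u, heatE 1 u * opposite (inner ℝ u a) (inner ℝ u b) =
      ENNReal.ofReal (InnerProductGeometry.angle a b / Real.pi) := by
  have hinv : ∀ (Q : E3 ≃ₗᵢ[ℝ] E3) (a b : E3),
      ∫⁻ u, heatE 1 u * opposite (inner ℝ u (Q a)) (inner ℝ u (Q b)) =
      ∫⁻ u, heatE 1 u * opposite (inner ℝ u a) (inner ℝ u b) := by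
    intro Q a b
    rw [← Q.measurePreserving.lintegral_comp (by fun_prop)]
    simp_rw [Q.inner_map_map, heatE_congr_norm (Q.norm_map _) one_pos]
  obtain ⟨Q₁, hQ₁, -⟩ := exists_linearIsometryEquiv_apply_eq
    (v := a) (w := EuclideanSpace.single 0 ‖a‖) (by simp)
  set β := (Q₁ b) 0 with hβ
  set r := √((Q₁ b) 1 ^ 2 + (Q₁ b) 2 ^ 2) with hr
  have hr0 : 0 ≤ r := Real.sqrt_nonneg _
  have hr2 : r ^ 2 = (Q₁ b) 1 ^ 2 + (Q₁ b) 2 ^ 2 := Real.sq_sqrt (by positivity)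
  have hnorm : ‖Q₁ b‖ = ‖(!₂[β, r, 0] : E3)‖ := by
    rw [EuclideanSpace.norm_eq, EuclideanSpace.norm_eq]
    simp [Fin.sum_univ_three, hr2, ← hβ, add_assoc]
  -- With `a` already on the first axis, the second isometry brings `b` into the plane of the first
  -- two axes. It fixes the image of `a` because the first coordinate of `b` is unchanged.
  obtain ⟨Q₂, hQ₂, hQ₂'⟩ := exists_linearIsometryEquiv_apply_eq hnorm
  have hfix : Q₂ (Q₁ a) = EuclideanSpace.single 0 ‖a‖ := by
    rw [hQ₁]
    apply hQ₂'
    simp [EuclideanSpace.inner_single_left, hβ]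
  have hbn : ‖b‖ = √(β ^ 2 + r ^ 2) := by
    rw [← Q₁.norm_map, hnorm, EuclideanSpace.norm_eq]
    simp [Fin.sum_univ_three]
  have hangle : InnerProductGeometry.angle a b = Real.arccos (β / √(β ^ 2 + r ^ 2)) := by
    rw [← hbn, InnerProductGeometry.angle, ← Q₁.inner_map_map, hQ₁,
      EuclideanSpace.inner_single_left]
    congr 1
    have := norm_ne_zero_iff.2 ha
    have := norm_ne_zero_iff.2 hb
    simp [← hβ]
    field_simp
  rw [← hinv Q₁, ← hinv Q₂, hfix, hQ₂, hangle, lintegral_E3_eq (by fun_prop)]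
  have h1 : ∀ x y z : ℝ, heatE 1 !₂[x, y, z] *
      opposite (inner ℝ !₂[x, y, z] (EuclideanSpace.single 0 ‖a‖ : E3))
        (inner ℝ !₂[x, y, z] (!₂[β, r, 0] : E3)) =
      heat 1 x * heat 1 y * opposite x (β * x + r * y) * heat 1 z := by
    intro x y z
    have e1 : inner ℝ !₂[x, y, z] (EuclideanSpace.single 0 ‖a‖ : E3) = ‖a‖ * x := by
      simp [EuclideanSpace.inner_single_right]
    have e2 : inner ℝ !₂[x, y, z] (!₂[β, r, 0] : E3) = β * x + r * y := by
      simp [PiLp.inner_apply, Fin.sum_univ_three]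
    rw [e1, e2, opposite_mul_left (norm_pos_iff.2 ha)]
    simp [heatE, Fin.prod_univ_three]
    ring
  simp_rw [h1]
  have h2 : ∀ x y : ℝ, ∫⁻ z, heat 1 x * heat 1 y * opposite x (β * x + r * y) * heat 1 z =
      heat 1 x * heat 1 y * opposite x (β * x + r * y) := by
    intro x y
    rw [lintegral_const_mul _ (by fun_prop), lintegral_heat one_pos, mul_one]
  simp_rw [h2]
  rcases hr0.eq_or_lt with h | h
  · rw [← h] at hbn ⊢
    have hβ0 : β ≠ 0 := by
      intro h0
      apply hb
      rw [← norm_eq_zero, hbn, h0]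
      simp
    simpa using lintegral_heat_mul_opposite_self hβ0
  · exact lintegral_heat_mul_opposite h

/-- After the angle is replaced by a separation probability and the integrals are exchanged, the
inner integral is the same for every normal `u ≠ 0`, so averaging over `u` changes nothing. -/
theorem lintegral_angle_mul_besselE (m : ℕ) :
    ∫⁻ z : E3 × E3, ENNReal.ofReal (InnerProductGeometry.angle z.1 z.2) *
      (besselE 0 z.1 * (besselE 0 z.2 * besselE m (z.1 + z.2))) =
    ENNReal.ofReal (Real.pi * ((m + 2) / (2 * m + 3))) * besselE (m + 2) 0 := by
  have hpi := Real.pi_pos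
  have h0 : ∀ᵐ z : E3 × E3, z.1 ≠ 0 ∧ z.2 ≠ 0 := by
    have h : ∀ᵐ x : E3, x ≠ 0 := by simp [ae_iff]
    rw [Measure.volume_eq_prod]
    filter_upwards [Measure.quasiMeasurePreserving_fst.ae h,
      Measure.quasiMeasurePreserving_snd.ae h] with z h1 h2
    exact ⟨h1, h2⟩
  have h1 : ∀ᵐ z : E3 × E3, ENNReal.ofReal (InnerProductGeometry.angle z.1 z.2) *
      (besselE 0 z.1 * (besselE 0 z.2 * besselE m (z.1 + z.2))) =
      ∫⁻ u, ENNReal.ofReal Real.pi * (heatE 1 u * (opposite (inner ℝ u z.1) (inner ℝ u z.2) *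
        (besselE 0 z.1 * (besselE 0 z.2 * besselE m (z.1 + z.2))))) := by
    filter_upwards [h0] with z hz
    have h : InnerProductGeometry.angle z.1 z.2 =
        Real.pi * (InnerProductGeometry.angle z.1 z.2 / Real.pi) := by field_simp
    rw [h, ENNReal.ofReal_mul hpi.le, ← lintegral_heatE_mul_opposite_inner hz.1 hz.2,
      lintegral_const_mul _ (by fun_prop), mul_assoc, ← lintegral_mul_const _ (by fun_prop)]
    simp_rw [mul_assoc]
  rw [lintegral_congr_ae h1, lintegral_lintegral_swap (Measurable.aemeasurable
    (by unfold Function.uncurry; fun_prop))]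
  have h2 : ∀ᵐ u : E3, ∫⁻ z : E3 × E3, ENNReal.ofReal Real.pi * (heatE 1 u *
      (opposite (inner ℝ u z.1) (inner ℝ u z.2) *
        (besselE 0 z.1 * (besselE 0 z.2 * besselE m (z.1 + z.2))))) =
      ENNReal.ofReal (Real.pi * ((m + 2) / (2 * m + 3))) * besselE (m + 2) 0 * heatE 1 u := by
    have h : ∀ᵐ x : E3, x ≠ 0 := by simp [ae_iff]
    filter_upwards [h] with u hu
    rw [lintegral_const_mul _ (by fun_prop), lintegral_const_mul _ (by fun_prop),
      lintegral_opposite_inner_mul_besselE m hu, ENNReal.ofReal_mul hpi.le]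
    ring
  rw [lintegral_congr_ae h2, lintegral_const_mul _ (by fun_prop), lintegral_heatE one_pos, mul_one]

/-! ### The density of the Hopf image of a Gaussian quaternion -/

-- Only the square of the prefactor `A` is recorded: the coordinates are integrated in pairs with
-- the same `β`, so no branch of the square root has to be chosen.
open Complex in
theorem exists_integral_cexp_gaussianReal {β : ℂ} (hβ : -(1 / 2) < β.re) :
    ∃ A : ℂ, A ^ 2 = (1 + 2 * β)⁻¹ ∧ ∀ c : ℂ,
      ∫ x : ℝ, cexp (-β * x ^ 2 + c * x) ∂(ProbabilityTheory.gaussianReal 0 1) =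
        A * cexp (c ^ 2 / (2 * (1 + 2 * β))) := by
  have hpi : (Real.pi : ℂ) ≠ 0 := by exact_mod_cast Real.pi_ne_zero
  have hb : (β + 1 / 2).re = β.re + 1 / 2 := by simp
  have hne : β + 1 / 2 ≠ 0 := by
    intro h
    rw [h] at hb
    simp at hb
    linarith
  have hne' : 1 + 2 * β ≠ 0 := by
    intro h
    apply hne
    linear_combination h / 2
  refine ⟨((√(2 * Real.pi))⁻¹ : ℝ) * (Real.pi / (β + 1 / 2)) ^ (1 / 2 : ℂ), ?_, fun c => ?_⟩
  · rw [mul_pow, ← cpow_nat_mul, ← ofReal_pow, inv_pow, Real.sq_sqrt (by positivity)]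
    rw [show β + 1 / 2 = (1 + 2 * β) / 2 by ring]
    norm_num
    field_simp
  · rw [ProbabilityTheory.integral_gaussianReal_eq_integral_smul one_ne_zero]
    have h : ∀ x : ℝ, ProbabilityTheory.gaussianPDFReal 0 1 x • cexp (-β * x ^ 2 + c * x) =
        ((√(2 * Real.pi))⁻¹ : ℝ) * cexp (-(β + 1 / 2) * x ^ 2 + c * x + 0) := by
      intro x
      rw [ProbabilityTheory.gaussianPDFReal, real_smul, ofReal_mul, ofReal_exp, mul_assoc, ← exp_add]
      congr 1
      · simp
      · congr 1
        push_cast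
        simp
        ring
    simp_rw [h]
    rw [integral_const_mul, integral_cexp_quadratic (by rw [neg_re, hb]; linarith), mul_assoc]
    congr 3
    · rw [neg_neg]
    · rw [zero_sub, ← div_neg]
      congr 1
      ring

open Complex in
theorem integral_integral_cexp_gaussianReal {β : ℂ} (hβ : -(1 / 2) < β.re) (e c d : ℂ) :
    ∫ x : ℝ, ∫ y : ℝ, cexp (e + (-β * x ^ 2 + c * x) + (-β * y ^ 2 + d * y))
      ∂(ProbabilityTheory.gaussianReal 0 1) ∂(ProbabilityTheory.gaussianReal 0 1) =
      (1 + 2 * β)⁻¹ * cexp (e + (c ^ 2 + d ^ 2) / (2 * (1 + 2 * β))) := by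
  obtain ⟨A, hA, h⟩ := exists_integral_cexp_gaussianReal hβ
  simp_rw [exp_add, integral_const_mul, ← exp_add, h, integral_mul_const, exp_add,
    integral_const_mul, ← exp_add, h]
  rw [← hA, add_div, ← add_assoc, exp_add, exp_add]
  ring

theorem integral_pi_fin_four {μ : Measure ℝ} [IsProbabilityMeasure μ] {f : (Fin 4 → ℝ) → ℂ}
    (hf : Measurable f) {C : ℝ} (hC : ∀ x, ‖f x‖ ≤ C) :
    ∫ q, f q ∂(Measure.pi fun _ => μ) = ∫ x, ∫ y, ∫ z, ∫ w, f ![x, y, z, w] ∂μ ∂μ ∂μ ∂μ := by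
  have hint : ∀ {α : Type} [MeasurableSpace α] {ν : Measure α} [IsProbabilityMeasure ν] {g : α → ℂ},
      Measurable g → (∀ x, ‖g x‖ ≤ C) → Integrable g ν := fun hg hgC =>
    Integrable.of_bound hg.aestronglyMeasurable C (Filter.Eventually.of_forall hgC)
  rw [← (measurePreserving_piFinSuccAbove (fun _ : Fin 4 => μ) 0).symm.integral_comp',
    integral_prod _ (hint (by fun_prop) fun _ => hC _)]
  congr 1
  ext x
  rw [← (measurePreserving_piFinSuccAbove (fun _ : Fin 3 => μ) 0).symm.integral_comp',
    integral_prod _ (hint (by fun_prop) fun _ => hC _)]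
  congr 1
  ext y
  rw [← (measurePreserving_finTwoArrow μ).symm.integral_comp',
    integral_prod _ (hint (by fun_prop) fun _ => hC _)]
  congr 1
  ext z
  congr 1
  ext w
  congr 1
  ext k
  fin_cases k <;> rfl

/-- The Hopf map on `ℝ⁴`. -/
def hopfFour (q : Fin 4 → ℝ) : E3 := hopf ⟨q 0, q 1, q 2, q 3⟩

theorem hopfFour_eq (q : Fin 4 → ℝ) : hopfFour q =
    !₂[q 0 ^ 2 + q 1 ^ 2 - q 2 ^ 2 - q 3 ^ 2, 2 * q 1 * q 2 - 2 * q 0 * q 3,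
      2 * q 0 * q 2 + 2 * q 1 * q 3] :=
  hopf_eq _

theorem measurable_hopfFour : Measurable hopfFour := by
  rw [funext hopfFour_eq]
  apply (WithLp.measurable_toLp 2 _).comp
  rw [measurable_pi_iff]
  intro k
  fin_cases k <;> simp <;> fun_prop

-- For fixed `q 0`, `q 1` the phase is quadratic in `q 2`, `q 3` without a cross term. The squares
-- of its two linear coefficients sum to a multiple of `q 0 ^ 2 + q 1 ^ 2`, so after this pair is
-- integrated out the other pair is again Gaussian, with a new complex parameter `β`.
open Complex in
theorem charFun_map_hopfFour (ξ : E3) :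
    charFun ((Measure.pi fun _ : Fin 4 => ProbabilityTheory.gaussianReal 0 1).map hopfFour) ξ =
      ((1 / (1 + 4 * ‖ξ‖ ^ 2) : ℝ) : ℂ) := by
  rw [charFun_apply, integral_map measurable_hopfFour.aemeasurable
    (by fun_prop), integral_pi_fin_four (C := 1)]
  · have hexp : ∀ x y z w : ℝ, cexp (inner ℝ (hopfFour ![x, y, z, w]) ξ * I) =
        cexp ((I * ξ 0 * (x ^ 2 + y ^ 2) +
          (-(I * ξ 0) * z ^ 2 + 2 * I * (ξ 1 * y + ξ 2 * x) * z)) +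
          (-(I * ξ 0) * w ^ 2 + 2 * I * (ξ 2 * y - ξ 1 * x) * w)) := by
      intro x y z w
      congr 1
      simp [hopfFour_eq, PiLp.inner_apply, Fin.sum_univ_three]
      ring
    have hne : 1 + 2 * (I * ξ 0) ≠ 0 := by
      intro h
      have := congrArg Complex.re h
      simp at this
    set β : ℂ := -(I * ξ 0) + 2 * (ξ 1 ^ 2 + ξ 2 ^ 2) / (1 + 2 * (I * ξ 0)) with hβ
    -- Clearing the complex denominator with its conjugate shows that the real part is in fact
    -- nonnegative.
    have hβre : -(1 / 2) < β.re := by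
      have h1 : β = -(I * ξ 0) + ((2 * (ξ 1 ^ 2 + ξ 2 ^ 2) / (1 + 4 * ξ 0 ^ 2) : ℝ) : ℂ) *
          (1 - 2 * (I * ξ 0)) := by
        have h2 : (1 + 4 * (ξ 0 : ℂ) ^ 2) = (1 + 2 * (I * ξ 0)) * (1 - 2 * (I * ξ 0)) := by
          linear_combination 4 * (ξ 0 : ℂ) ^ 2 * I_sq
        have h3 : (1 + 4 * (ξ 0 : ℂ) ^ 2) ≠ 0 := by
          have : (1 + 4 * ξ 0 ^ 2 : ℝ) ≠ 0 := by positivity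
          exact_mod_cast this
        rw [hβ]
        push_cast
        congr 1
        rw [div_mul_eq_mul_div, div_eq_div_iff hne h3, h2]
        ring
      rw [h1]
      have h4 : 0 ≤ 2 * (ξ 1 ^ 2 + ξ 2 ^ 2) / (1 + 4 * ξ 0 ^ 2) := by positivity
      rw [add_re, re_ofReal_mul]
      simp
      linarith
    simp_rw [hexp]
    have hin : ∀ x y : ℝ, ∫ z : ℝ, ∫ w : ℝ, cexp ((I * ξ 0 * (x ^ 2 + y ^ 2) +
          (-(I * ξ 0) * z ^ 2 + 2 * I * (ξ 1 * y + ξ 2 * x) * z)) +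
          (-(I * ξ 0) * w ^ 2 + 2 * I * (ξ 2 * y - ξ 1 * x) * w))
          ∂(ProbabilityTheory.gaussianReal 0 1) ∂(ProbabilityTheory.gaussianReal 0 1) =
        (1 + 2 * (I * ξ 0))⁻¹ * cexp (0 + (-β * x ^ 2 + 0 * x) + (-β * y ^ 2 + 0 * y)) := by
      intro x y
      rw [integral_integral_cexp_gaussianReal (by simp)]
      congr 2
      rw [hβ, show (2 * I * (ξ 1 * y + ξ 2 * x)) ^ 2 + (2 * I * (ξ 2 * y - ξ 1 * x)) ^ 2 =
        -4 * (ξ 1 ^ 2 + ξ 2 ^ 2) * ((x : ℂ) ^ 2 + y ^ 2) by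
          linear_combination 4 * (ξ 1 ^ 2 + ξ 2 ^ 2) * ((x : ℂ) ^ 2 + y ^ 2) * I_sq]
      generalize 1 + 2 * (I * (ξ 0 : ℂ)) = D at *
      field_simp
      ring
    simp_rw [hin]
    simp_rw [integral_const_mul]
    rw [integral_integral_cexp_gaussianReal hβre]
    have hn : ‖ξ‖ ^ 2 = ξ 0 ^ 2 + ξ 1 ^ 2 + ξ 2 ^ 2 := by
      rw [EuclideanSpace.real_norm_sq_eq, Fin.sum_univ_three]
    have hprod : (1 + 2 * (I * ξ 0)) * (1 + 2 * β) =
        ((1 + 4 * (ξ 0 ^ 2 + ξ 1 ^ 2 + ξ 2 ^ 2) : ℝ) : ℂ) := by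
      have h : (1 + 2 * (I * ξ 0)) * (1 + 2 * β) =
          (1 + 2 * (I * ξ 0)) * (1 - 2 * (I * ξ 0)) + 4 * (ξ 1 ^ 2 + ξ 2 ^ 2) := by
        rw [hβ]
        generalize 1 + 2 * (I * (ξ 0 : ℂ)) = D at *
        field_simp
        ring
      rw [h]
      push_cast
      linear_combination -4 * (ξ 0 : ℂ) ^ 2 * I_sq
    rw [← mul_assoc, ← mul_inv, hprod, hn]
    simp
  · exact (by fun_prop : Continuous fun v : E3 => cexp (inner ℝ v ξ * I)).measurable.comp
      measurable_hopfFour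
  · intro q
    rw [norm_exp_ofReal_mul_I]

theorem lintegral_gammaWeight_zero {l : ℝ} (hl : 0 < l) :
    ∫⁻ t in Ioi (0 : ℝ), gammaWeight 0 l t = ENNReal.ofReal (1 / l) := by
  have := lintegral_exp_neg_mul_Ioi hl 0
  simpa [gammaWeight] using this

theorem lintegral_besselE_zero : ∫⁻ v, besselE 0 v = 1 := by
  unfold besselE
  rw [lintegral_lintegral_swap (Measurable.aemeasurable (by unfold Function.uncurry; fun_prop))]
  have h : ∀ t ∈ Ioi (0 : ℝ), ∫⁻ v, gammaWeight 0 1 t * heatE t v = gammaWeight 0 1 t := by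
    intro t ht
    rw [lintegral_const_mul _ (by fun_prop), lintegral_heatE ht, mul_one]
  rw [setLIntegral_congr_fun measurableSet_Ioi h, lintegral_gammaWeight_zero one_pos]
  simp

instance isProbabilityMeasure_withDensity_besselE :
    IsProbabilityMeasure ((volume : Measure E3).withDensity (besselE 0)) :=
  ⟨by rw [withDensity_apply _ MeasurableSet.univ, setLIntegral_univ, lintegral_besselE_zero]⟩

open Complex in
theorem charFun_withDensity_besselE (ξ : E3) :
    charFun ((volume : Measure E3).withDensity (besselE 0)) ξ =
      ((1 / (1 + 4 * ‖ξ‖ ^ 2) : ℝ) : ℂ) := by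
  have hpi := Real.pi_pos
  set F : ℝ × E3 → ℝ≥0∞ := fun p => gammaWeight 0 1 p.1 * heatE p.1 p.2 with hF
  have hFm : Measurable F := by fun_prop
  set κ : Measure ℝ := volume.restrict (Ioi 0)
  -- The joint law of the mixing time and the vector; its second marginal is the mixture, which
  -- makes Fubini available for the oscillating integrand.
  set M : Measure (ℝ × E3) := (κ.prod volume).withDensity F with hM
  have hmap : M.map Prod.snd = (volume : Measure E3).withDensity (besselE 0) := by
    ext s hs
    rw [Measure.map_apply measurable_snd hs, hM, withDensity_apply _ (measurable_snd hs),
      withDensity_apply _ hs, ← univ_prod, ← Measure.prod_restrict, Measure.restrict_univ,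
      lintegral_prod_symm' _ hFm]
    rfl
  have hFtop : ∀ p, F p < ∞ := fun p => by
    simp only [hF, gammaWeight, heatE, heat]
    rw [← ENNReal.ofReal_prod_of_nonneg (fun k _ => by positivity)]
    exact ENNReal.mul_lt_top ENNReal.ofReal_lt_top ENNReal.ofReal_lt_top
  have hMfin : IsFiniteMeasure M := by
    refine ⟨?_⟩
    rw [← preimage_univ (f := (Prod.snd : ℝ × E3 → E3)),
      ← Measure.map_apply measurable_snd MeasurableSet.univ, hmap]
    exact measure_lt_top _ _
  have hint : Integrable (fun p : ℝ × E3 => cexp (inner ℝ p.2 ξ * I)) M :=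
    Integrable.of_bound (by fun_prop : Continuous fun p : ℝ × E3 =>
      cexp (inner ℝ p.2 ξ * I)).aestronglyMeasurable 1
      (Filter.Eventually.of_forall fun p => by rw [norm_exp_ofReal_mul_I])
  rw [charFun_apply, ← hmap, integral_map measurable_snd.aemeasurable (by fun_prop), hM,
    integral_withDensity_eq_integral_toReal_smul hFm (Filter.Eventually.of_forall hFtop),
    integral_prod]
  · have h1 : ∀ t ∈ Ioi (0 : ℝ), ∫ v : E3, (F (t, v)).toReal • cexp (inner ℝ v ξ * I) =
        ((Real.exp (-(1 + 4 * ‖ξ‖ ^ 2) * t) : ℝ) : ℂ) := by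
      intro t ht
      rw [mem_Ioi] at ht
      have hs0 : 0 < √(16 * Real.pi * t) := by positivity
      have htC : (t : ℂ) ≠ 0 := by exact_mod_cast ht.ne'
      have h2 : ∀ v : E3, (F (t, v)).toReal • cexp (inner ℝ v ξ * I) =
          ((Real.exp (-t) * (√(16 * Real.pi * t))⁻¹ ^ 3 : ℝ) : ℂ) *
            cexp (-((1 / (16 * t) : ℝ) : ℂ) * ‖v‖ ^ 2 + I * inner ℝ ξ v) := by
        intro v
        simp only [hF]
        rw [heatE_eq ht, gammaWeight, ENNReal.toReal_mul, ENNReal.toReal_ofReal (by positivity),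
          ENNReal.toReal_ofReal (by positivity), real_smul, exp_add, real_inner_comm v ξ,
          mul_comm I]
        push_cast
        simp
        ring_nf
      simp_rw [h2]
      rw [integral_const_mul, GaussianFourier.integral_cexp_neg_mul_sq_norm_add
        (by rw [ofReal_re]; positivity)]
      have h3 : ((Real.pi : ℂ) / ((1 / (16 * t) : ℝ) : ℂ)) ^ ((finrank ℝ E3 : ℂ) / 2) =
          ((√(16 * Real.pi * t) ^ 3 : ℝ) : ℂ) := by
        rw [show (Real.pi : ℂ) / ((1 / (16 * t) : ℝ) : ℂ) = ((16 * Real.pi * t : ℝ) : ℂ) by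
          push_cast; field_simp]
        rw [finrank_euclideanSpace_fin, Real.sqrt_eq_rpow, ← Real.rpow_natCast,
          ← Real.rpow_mul (by positivity), ofReal_cpow (by positivity)]
        congr 1
        push_cast
        ring
      rw [h3, ← mul_assoc, ← ofReal_mul, mul_assoc, ← mul_pow, inv_mul_cancel₀ hs0.ne', one_pow,
        mul_one, ofReal_exp, ofReal_exp, ← exp_add]
      congr 1
      push_cast
      field_simp
      rw [I_sq]
      ring
    rw [setIntegral_congr_fun measurableSet_Ioi h1, integral_complex_ofReal, integral_exp_mul_Ioi
      (by nlinarith [sq_nonneg ‖ξ‖])]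
    congr 1
    rw [mul_zero, Real.exp_zero, neg_div_neg_eq]
  · exact (integrable_withDensity_iff_integrable_smul' hFm
      (Filter.Eventually.of_forall hFtop)).1 hint

/-- The Hopf image of a Gaussian quaternion has density `besselE 0`. -/
theorem map_hopfFour :
    (Measure.pi fun _ : Fin 4 => ProbabilityTheory.gaussianReal 0 1).map hopfFour =
      (volume : Measure E3).withDensity (besselE 0) := by
  have : IsProbabilityMeasure
      ((Measure.pi fun _ : Fin 4 => ProbabilityTheory.gaussianReal 0 1).map hopfFour) :=
    Measure.isProbabilityMeasure_map measurable_hopfFour.aemeasurable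
  refine Measure.ext_of_charFun ?_
  ext ξ
  rw [charFun_map_hopfFour, charFun_withDensity_besselE]

/-! ### The continuous density on arms -/

theorem continuous_heatE {t : ℝ} (ht : 0 < t) : Continuous (heatE t) := by
  rw [funext (heatE_eq ht)]
  exact ENNReal.continuous_ofReal.comp (by fun_prop)

theorem heatE_le_of_norm_le {v w : E3} (h : ‖v‖ ≤ ‖w‖) {t : ℝ} (ht : 0 < t) :
    heatE t w ≤ heatE t v := by
  rw [heatE_eq ht, heatE_eq ht]
  gcongr

theorem besselE_le_of_norm_le {v w : E3} (h : ‖v‖ ≤ ‖w‖) (k : ℕ) : besselE k w ≤ besselE k v :=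
  setLIntegral_mono' measurableSet_Ioi fun _ ht => by gcongr; exact heatE_le_of_norm_le h ht

theorem besselE_zero_ne_zero (v : E3) : besselE 0 v ≠ 0 := by
  rw [besselE, ← pos_iff_ne_zero, setLIntegral_pos_iff (by fun_prop)]
  have : (Function.support fun t => gammaWeight 0 1 t * heatE t v) ∩ Ioi 0 = Ioi 0 := by
    refine inter_eq_right.2 fun t ht => ?_
    rw [mem_Ioi] at ht
    rw [Function.mem_support, heatE_eq ht, gammaWeight]
    have := Real.pi_pos
    refine mul_ne_zero ?_ ?_ <;> simp only [ne_eq, ENNReal.ofReal_eq_zero, not_le] <;> positivity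
  rw [this]
  simp

/-- The density is integrable, hence finite at some point closer to the origin than `v`, and it
decreases with the norm. -/
theorem besselE_zero_ne_top {v : E3} (hv : v ≠ 0) : besselE 0 v ≠ ∞ := by
  have h : ∀ᵐ w : E3, besselE 0 w < ∞ :=
    ae_lt_top (by fun_prop) (by rw [lintegral_besselE_zero]; exact ENNReal.one_ne_top)
  have hpos : (volume : Measure E3) (Metric.ball 0 ‖v‖) ≠ 0 :=
    (Metric.measure_ball_pos _ _ (norm_pos_iff.2 hv)).ne'
  obtain ⟨w, hw, hw'⟩ : ∃ w ∈ Metric.ball (0 : E3) ‖v‖, besselE 0 w < ∞ := by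
    by_contra! hcon
    refine hpos (measure_mono_null (fun w hw => ?_) h)
    simpa using hcon w hw
  rw [mem_ball_zero_iff] at hw
  exact ((besselE_le_of_norm_le hw.le 0).trans_lt hw').ne

/-- At the origin, Fatou's lemma gives the lower bound and radial monotonicity the upper one, with
no need for a finite value there. Elsewhere convergence is dominated by the integrand at `v / 2`. -/
theorem continuous_besselE_zero : Continuous (besselE 0) := by
  refine continuous_iff_continuousAt.2 fun v => ?_
  by_cases hv : v = 0
  · subst hv
    refine tendsto_of_seq_tendsto fun u hu => ?_
    refine tendsto_of_le_liminf_of_limsup_le ?_ ?_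
    · refine le_trans (le_of_eq ?_) (lintegral_liminf_le fun n => by fun_prop)
      refine setLIntegral_congr_fun measurableSet_Ioi fun t ht => ?_
      refine (Tendsto.liminf_eq ?_).symm
      exact ENNReal.Tendsto.const_mul (((continuous_heatE ht).tendsto 0).comp hu)
        (Or.inr ENNReal.ofReal_ne_top)
    · refine limsup_le_of_le (by isBoundedDefault) (Eventually.of_forall fun n => ?_)
      exact besselE_le_of_norm_le (by simp) 0
  · have hv2 : (1 / 2 : ℝ) • v ≠ 0 := smul_ne_zero (by norm_num) hv
    refine tendsto_lintegral_filter_of_dominated_convergence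
      (fun t => gammaWeight 0 1 t * heatE t ((1 / 2 : ℝ) • v))
      (Eventually.of_forall fun w => by fun_prop) ?_ (besselE_zero_ne_top hv2) ?_
    · have hlt : ‖(1 / 2 : ℝ) • v‖ < ‖v‖ := by
        rw [norm_smul]
        norm_num
        linarith [norm_pos_iff.2 hv]
      filter_upwards [continuous_norm.continuousAt.eventually (lt_mem_nhds hlt)] with w hw
      filter_upwards [ae_restrict_mem measurableSet_Ioi] with t ht
      gcongr
      exact heatE_le_of_norm_le hw.le ht
    · filter_upwards [ae_restrict_mem measurableSet_Ioi] with t ht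
      exact ENNReal.Tendsto.const_mul ((continuous_heatE ht).tendsto v)
        (Or.inr ENNReal.ofReal_ne_top)

/-- Multiplication on `[0, ∞]` fails to be continuous only at `0 * ∞`, which nonvanishing factors
exclude. -/
theorem continuous_finset_prod_ennreal {X ι : Type*} [TopologicalSpace X] (s : Finset ι)
    {f : ι → X → ℝ≥0∞} (hf : ∀ i, Continuous (f i)) (h0 : ∀ i x, f i x ≠ 0) :
    Continuous fun x => ∏ i ∈ s, f i x := by
  classical
  induction s using Finset.induction_on with
  | empty => simpa using continuous_const
  | insert i s hi ih =>
    simp_rw [Finset.prod_insert hi]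
    refine continuous_iff_continuousAt.2 fun x => ?_
    exact ENNReal.Tendsto.mul (hf i).continuousAt (Or.inl (h0 i x)) ih.continuousAt
      (Or.inl (Finset.prod_ne_zero_iff.2 fun j _ => h0 j x))

theorem pi_withDensity {n : ℕ} {E : Type*} [MeasurableSpace E] {μ : Measure E} [SigmaFinite μ]
    {f : E → ℝ≥0∞} (hf : Measurable f) [SigmaFinite (μ.withDensity f)] :
    Measure.pi (fun _ : Fin n => μ.withDensity f) =
      (Measure.pi fun _ : Fin n => μ).withDensity fun x => ∏ i, f (x i) := by
  refine Measure.pi_eq fun s hs => ?_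
  rw [withDensity_apply _ (MeasurableSet.univ_pi hs), Measure.restrict_pi_pi,
    lintegral_fin_prod_eq_prod (f := fun _ => f) fun _ => hf]
  simp_rw [withDensity_apply _ (hs _)]

theorem exists_isContinuousDensity_armMeasure (n : ℕ) : ∃ c : ℝ≥0∞, c ≠ 0 ∧ c ≠ ∞ ∧
    IsContinuousDensity (armMeasure n) fun e => c * ∏ l, besselE 0 (e l) := by
  set P : Measure (Fin n → E3) := Measure.pi fun _ => volume with hP
  have hmeas : Measurable fun e : Arm n => ∏ l, besselE 0 (e l) := by fun_prop
  have h1 : armMeasure n = (P.withDensity fun x => ∏ l, besselE 0 (x l)).map (WithLp.toLp 2) := by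
    have : IsProbabilityMeasure
        ((Measure.pi fun _ : Fin 4 => ProbabilityTheory.gaussianReal 0 1).map hopfFour) :=
      Measure.isProbabilityMeasure_map measurable_hopfFour.aemeasurable
    have h := Measure.pi_map_pi (μ := fun _ : Fin n => Measure.pi fun _ : Fin 4 =>
      ProbabilityTheory.gaussianReal 0 1) (f := fun _ => hopfFour)
      fun _ => measurable_hopfFour.aemeasurable
    simp_rw [map_hopfFour] at h
    rw [hP, ← pi_withDensity (by fun_prop), ← h, Measure.map_map (by fun_prop)]
    · rfl
    · exact measurable_pi_iff.2 fun i => measurable_hopfFour.comp (measurable_pi_apply i)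
  -- Uniqueness of Haar measure compares product and Euclidean volume up to a constant; its value is
  -- irrelevant because the closed measure is normalized.
  have hhaar : (P.map (WithLp.toLp 2) : Measure (Arm n)).IsAddHaarMeasure :=
    (PiLp.continuousLinearEquiv 2 ℝ (fun _ : Fin n => E3)).symm.isAddHaarMeasure_map P
  set c := (P.map (WithLp.toLp 2) : Measure (Arm n)).addHaarScalarFactor volume with hc
  have hc' : (P.map (WithLp.toLp 2) : Measure (Arm n)) = c • volume :=
    Measure.isAddLeftInvariant_eq_smul _ _
  have hc0 : c ≠ 0 := by
    intro h
    rw [h, zero_smul] at hc'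
    exact hhaar.toIsOpenPosMeasure.open_pos univ isOpen_univ univ_nonempty (by rw [hc']; rfl)
  refine ⟨c, by exact_mod_cast hc0, ENNReal.coe_ne_top, ?_, ?_⟩
  · exact (ENNReal.continuous_const_mul ENNReal.coe_ne_top).comp
      (continuous_finset_prod_ennreal _ (fun l => continuous_besselE_zero.comp (by fun_prop))
        fun l e => besselE_zero_ne_zero _)
  · have h2 : (P.withDensity fun x => ∏ l, besselE 0 (x l)).map (WithLp.toLp 2) =
        (P.map (WithLp.toLp 2) : Measure (Arm n)).withDensity fun e => ∏ l, besselE 0 (e l) := by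
      ext s hs
      have ht : Measurable (WithLp.toLp 2 : (Fin n → E3) → Arm n) := by fun_prop
      rw [Measure.map_apply ht hs, withDensity_apply _ hs, withDensity_apply _ (ht hs),
        setLIntegral_map hs hmeas ht]
    rw [h1, h2, hc']
    ext s hs
    rw [withDensity_apply _ hs, withDensity_apply _ hs, lintegral_const_mul _ hmeas,
      Measure.restrict_smul, lintegral_smul_measure]
    rfl

/-! ### The law of two edges of a closed polygon -/

theorem lintegral_fin_cons {n : ℕ} {f : (Fin (n + 1) → E3) → ℝ≥0∞} (hf : Measurable f) :
    ∫⁻ x, f x = ∫⁻ a, ∫⁻ x : Fin n → E3, f (Fin.cons a x) := by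
  rw [← (volume_preserving_piFinSuccAbove (fun _ : Fin (n + 1) => E3) 0).symm.lintegral_comp hf,
    Measure.volume_eq_prod, lintegral_prod _ (Measurable.aemeasurable (by fun_prop))]
  have h : ∀ (a : E3) (x : Fin n → E3),
      (MeasurableEquiv.piFinSuccAbove (fun _ : Fin (n + 1) => E3) 0).symm (a, x) = Fin.cons a x :=
    fun a x => Fin.insertNth_zero' a x
  simp_rw [h]

@[fun_prop]
theorem measurable_fin_cons {n : ℕ} {α : Type*} [MeasurableSpace α] {f : α → E3}
    {g : α → Fin n → E3} (hf : Measurable f) (hg : Measurable g) :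
    Measurable fun a => (Fin.cons (f a) (g a) : Fin (n + 1) → E3) := by
  refine measurable_pi_iff.2 fun i => ?_
  refine Fin.cases ?_ (fun j => ?_) i
  · simpa using hf
  · simpa [Function.comp_def] using (measurable_pi_apply j).comp hg

/-- Here `v` is the sum of the two distinguished edges. Of the other `m + 1` edges, `m` are free and
the last is determined by closure; each free edge integrated out raises the index by one. -/
theorem lintegral_pi_besselE (m : ℕ) (v : E3) :
    ∫⁻ x : Fin m → E3, (∏ l, besselE 0 (x l)) * besselE 0 (v + ∑ l, x l) = besselE m v := by
  induction m generalizing v with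
  | zero => simp [volume_pi]
  | succ m ih =>
    rw [lintegral_fin_cons (by fun_prop), ← lintegral_besselE_mul_besselE]
    congr 1
    ext a
    simp_rw [Fin.prod_univ_succ, Fin.sum_univ_succ, Fin.cons_zero, Fin.cons_succ, ← add_assoc,
      mul_assoc]
    rw [lintegral_const_mul _ (by fun_prop), ih]

theorem lintegral_pi_besselE_pair (m : ℕ) {F : E3 × E3 → ℝ≥0∞} (hF : Measurable F) :
    ∫⁻ x : Fin (m + 2) → E3, F (x 0, x 1) * (besselE 0 (∑ l, x l) * ∏ l, besselE 0 (x l)) =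
      ∫⁻ z : E3 × E3, F z * (besselE 0 z.1 * (besselE 0 z.2 * besselE m (z.1 + z.2))) := by
  rw [lintegral_fin_cons (by fun_prop), Measure.volume_eq_prod,
    lintegral_prod _ (Measurable.aemeasurable (by fun_prop))]
  congr 1
  ext a
  rw [lintegral_fin_cons (by fun_prop)]
  congr 1
  ext b
  have h : ∀ x : Fin m → E3, F ((Fin.cons a (Fin.cons b x : Fin (m + 1) → E3) : Fin (m + 2) → E3) 0,
      (Fin.cons a (Fin.cons b x : Fin (m + 1) → E3) : Fin (m + 2) → E3) 1) *
      (besselE 0 (∑ l, (Fin.cons a (Fin.cons b x : Fin (m + 1) → E3) : Fin (m + 2) → E3) l) *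
      ∏ l, besselE 0 ((Fin.cons a (Fin.cons b x : Fin (m + 1) → E3) : Fin (m + 2) → E3) l)) =
      F (a, b) * (besselE 0 a * (besselE 0 b *
        ((∏ l, besselE 0 (x l)) * besselE 0 (a + b + ∑ l, x l)))) := by
    intro x
    have : (Fin.cons a (Fin.cons b x : Fin (m + 1) → E3) : Fin (m + 2) → E3) 1 = b := rfl
    simp only [this, Fin.prod_univ_succ, Fin.sum_univ_succ, Fin.cons_zero, Fin.cons_succ, ← add_assoc]
    ring
  simp_rw [h]
  rw [lintegral_const_mul _ (by fun_prop), lintegral_const_mul _ (by fun_prop),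
    lintegral_const_mul _ (by fun_prop), lintegral_pi_besselE]

/-- Coordinates on closed polygons: all edges but one are free. -/
def closedPolygonEquiv {m n : ℕ} (σ : Fin (m + 1) ≃ Fin n) :
    (Fin m → E3) ≃ₗ[ℝ] ClosedPolygon n where
  toFun x := ⟨WithLp.toLp 2 fun l => (Fin.cons (-∑ k, x k) x : Fin (m + 1) → E3) (σ.symm l), by
    change ∑ l, (Fin.cons (-∑ k, x k) x : Fin (m + 1) → E3) (σ.symm l) = 0
    rw [σ.symm.sum_comp, Fin.sum_univ_succ]
    simp⟩
  invFun e k := (e : Arm n) (σ k.succ)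
  map_add' x y := by
    ext1
    refine PiLp.ext fun l => ?_
    change (Fin.cons _ _ : Fin (m + 1) → E3) (σ.symm l) =
      (Fin.cons _ _ : Fin (m + 1) → E3) (σ.symm l) + (Fin.cons _ _ : Fin (m + 1) → E3) (σ.symm l)
    refine Fin.cases ?_ (fun j => ?_) (σ.symm l)
    · simp [Finset.sum_add_distrib, add_comm]
    · simp
  map_smul' c x := by
    ext1
    refine PiLp.ext fun l => ?_
    change (Fin.cons _ _ : Fin (m + 1) → E3) (σ.symm l) =
      c • (Fin.cons _ _ : Fin (m + 1) → E3) (σ.symm l)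
    refine Fin.cases ?_ (fun j => ?_) (σ.symm l)
    · simp [Finset.smul_sum]
    · simp
  left_inv x := by
    ext1 k
    simp
  right_inv e := by
    ext1
    refine PiLp.ext fun l => ?_
    obtain ⟨k, rfl⟩ := σ.surjective l
    have he : ∑ l, (e : Arm n) l = 0 := e.2
    rw [← σ.sum_comp, Fin.sum_univ_succ] at he
    simp only [Equiv.symm_apply_apply]
    refine Fin.cases ?_ (fun j => ?_) k
    · rw [Fin.cons_zero, eq_comm, ← add_eq_zero_iff_eq_neg, he]
    · rw [Fin.cons_succ]

theorem closedPolygonEquiv_apply_succ {m n : ℕ} (σ : Fin (m + 1) ≃ Fin n) (x : Fin m → E3)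
    (k : Fin m) : (closedPolygonEquiv σ x : Arm n) (σ k.succ) = x k := by
  simp [closedPolygonEquiv]

theorem closedPolygonEquiv_apply_zero {m n : ℕ} (σ : Fin (m + 1) ≃ Fin n) (x : Fin m → E3) :
    (closedPolygonEquiv σ x : Arm n) (σ 0) = -∑ k, x k := by
  simp [closedPolygonEquiv]

/-- Position `0` is reserved for the edge determined by closure, so `i` and `j` become the first two
free edges. -/
theorem exists_equiv_apply_eq {m n : ℕ} (hn : n = m + 3) {i j : Fin n} (hij : i ≠ j) :
    ∃ σ : Fin (m + 2 + 1) ≃ Fin n, σ (0 : Fin (m + 2)).succ = i ∧ σ (1 : Fin (m + 2)).succ = j := by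
  set ε : Fin (m + 2 + 1) ≃ Fin n := finCongr hn.symm
  set τ := ε.trans (Equiv.swap (ε (0 : Fin (m + 2)).succ) i)
  have hne : (0 : Fin (m + 2)).succ ≠ (1 : Fin (m + 2)).succ :=
    (Fin.succ_injective _).ne (by simp)
  have hτ : τ (0 : Fin (m + 2)).succ = i := by
    simp [τ]
  have hy : (0 : Fin (m + 2)).succ ≠ τ.symm j := by
    intro h
    apply hij
    rw [← hτ, h, Equiv.apply_symm_apply]
  refine ⟨(Equiv.swap (1 : Fin (m + 2)).succ (τ.symm j)).trans τ, ?_, ?_⟩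
  · rw [Equiv.trans_apply, Equiv.swap_apply_of_ne_of_ne hne hy, hτ]
  · rw [Equiv.trans_apply, Equiv.swap_apply_left, Equiv.apply_symm_apply]

instance continuousSMul_closedPolygon {n : ℕ} : ContinuousSMul ℝ (ClosedPolygon n) :=
  IsBoundedSMul.continuousSMul

/-- Hausdorff measure and the image of Lebesgue measure are both Haar measures on the subspace, so
they are proportional. The Jacobian `d` cancels on normalization. -/
theorem exists_lintegral_hausdorffMeasure_eq {m n : ℕ} (σ : Fin (m + 1) ≃ Fin n) :
    ∃ d : ℝ≥0∞, d ≠ 0 ∧ d ≠ ∞ ∧ ∀ f : ClosedPolygon n → ℝ≥0∞, Measurable f →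
      ∫⁻ e, f e ∂(Measure.hausdorffMeasure (finrank ℝ (ClosedPolygon n) : ℝ)) =
        d * ∫⁻ x : Fin m → E3, f (closedPolygonEquiv σ x) := by
  have hcont : Continuous (closedPolygonEquiv σ) :=
    (closedPolygonEquiv σ).toLinearMap.continuous_of_finiteDimensional
  have hcont' : Continuous (closedPolygonEquiv σ).symm :=
    (closedPolygonEquiv σ).symm.toLinearMap.continuous_of_finiteDimensional
  have hH : (Measure.hausdorffMeasure (finrank ℝ (ClosedPolygon n) : ℝ) :
      Measure (ClosedPolygon n)).IsAddHaarMeasure := isAddHaarMeasure_hausdorffMeasure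
  generalize (Measure.hausdorffMeasure (finrank ℝ (ClosedPolygon n) : ℝ) :
      Measure (ClosedPolygon n)) = H at *
  have hhaar : (Measure.map (closedPolygonEquiv σ)
      (volume : Measure (Fin m → E3))).IsAddHaarMeasure :=
    (closedPolygonEquiv σ).toAddEquiv.isAddHaarMeasure_map volume hcont hcont'
  have hd := Measure.isAddLeftInvariant_eq_smul H
    (Measure.map (closedPolygonEquiv σ) (volume : Measure (Fin m → E3)))
  generalize H.addHaarScalarFactor
    (Measure.map (closedPolygonEquiv σ) (volume : Measure (Fin m → E3))) = d at hd
  have hd0 : d ≠ 0 := by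
    intro h
    rw [h, zero_smul] at hd
    exact hH.toIsOpenPosMeasure.open_pos univ isOpen_univ univ_nonempty (by rw [hd]; rfl)
  refine ⟨d, by exact_mod_cast hd0, ENNReal.coe_ne_top, fun f hf => ?_⟩
  rw [hd, lintegral_smul_measure, lintegral_map hf hcont.measurable]
  rfl

theorem exists_lintegral_restrictedMeasure {m n : ℕ} (hn : n = m + 3) {i j : Fin n} (hij : i ≠ j)
    {c : ℝ≥0∞} (hc0 : c ≠ 0) (hc : c ≠ ∞) :
    ∃ C : ℝ≥0∞, C ≠ 0 ∧ C ≠ ∞ ∧ ∀ F : E3 × E3 → ℝ≥0∞, Measurable F →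
      ∫⁻ e, F ((e : Arm n) i, (e : Arm n) j)
          ∂(restrictedMeasure fun e : Arm n => c * ∏ l, besselE 0 (e l)) =
        C * ∫⁻ z : E3 × E3, F z * (besselE 0 z.1 * (besselE 0 z.2 * besselE m (z.1 + z.2))) := by
  obtain ⟨σ, hi, hj⟩ := exists_equiv_apply_eq hn hij
  obtain ⟨d, hd0, hd, hint⟩ := exists_lintegral_hausdorffMeasure_eq σ
  refine ⟨d * c, mul_ne_zero hd0 hc0, ENNReal.mul_ne_top hd hc, fun F hF => ?_⟩
  have hm1 : Measurable fun e : ClosedPolygon n => F ((e : Arm n) i, (e : Arm n) j) := by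
    fun_prop
  have hm2 : Measurable fun e : ClosedPolygon n => c * ∏ l, besselE 0 ((e : Arm n) l) := by
    fun_prop
  rw [restrictedMeasure, lintegral_withDensity_eq_lintegral_mul _ hm2 hm1,
    hint _ (hm2.mul hm1), ← lintegral_pi_besselE_pair m hF, mul_assoc,
    ← lintegral_const_mul' _ _ hc]
  congr 2
  ext x
  simp only [Pi.mul_apply]
  -- The determined edge is minus the sum of the free ones; the sign disappears because the density
  -- is radial.
  rw [← σ.prod_comp, Fin.prod_univ_succ, closedPolygonEquiv_apply_zero, ← hi, ← hj,
    besselE_congr_norm (norm_neg (∑ k, x k))]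
  simp_rw [closedPolygonEquiv_apply_succ]
  ring

/-! ### The expected turning angle -/

theorem lintegral_besselE_three (m : ℕ) :
    ∫⁻ z : E3 × E3, besselE 0 z.1 * (besselE 0 z.2 * besselE m (z.1 + z.2)) =
      besselE (m + 2) 0 := by
  rw [Measure.volume_eq_prod, lintegral_prod _ (Measurable.aemeasurable (by fun_prop)),
    ← lintegral_besselE_mul_besselE]
  congr 1
  ext a
  dsimp only
  rw [lintegral_const_mul _ (by fun_prop), lintegral_besselE_mul_besselE, zero_add]

theorem measurable_angle :
    Measurable fun z : E3 × E3 => InnerProductGeometry.angle z.1 z.2 := by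
  unfold InnerProductGeometry.angle
  exact Real.continuous_arccos.measurable.comp (by fun_prop)

theorem measurable_edge {n : ℕ} (i : Fin n) :
    Measurable fun e : ClosedPolygon n => (e : Arm n) i := by
  fun_prop

theorem measurable_turningAngle {n : ℕ} (i j : Fin n) :
    Measurable (turningAngle i j : ClosedPolygon n → ℝ) := by
  unfold turningAngle
  have h := measurable_angle.comp ((measurable_edge i).prodMk (measurable_edge j))
  simp only [Function.comp_def] at h
  exact h

theorem turningAngle_nonneg {n : ℕ} (i j : Fin n) (e : ClosedPolygon n) : 0 ≤ turningAngle i j e :=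
  InnerProductGeometry.angle_nonneg _ _

theorem norm_turningAngle_le {n : ℕ} (i j : Fin n) (e : ClosedPolygon n) :
    ‖turningAngle i j e‖ ≤ Real.pi := by
  rw [Real.norm_of_nonneg (turningAngle_nonneg i j e)]
  exact InnerProductGeometry.angle_le_pi _ _

theorem integral_turningAngle {m n : ℕ} (hm : n = m + 3) {i j : Fin n} (hij : i ≠ j) :
    IsProbabilityMeasure (closedMeasure n) ∧ Integrable (turningAngle i j) (closedMeasure n) ∧
    ∫ e, turningAngle i j e ∂(closedMeasure n) = Real.pi * ((m + 2) / (2 * m + 3)) := by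
  obtain ⟨c, hc0, hc, hdens⟩ := exists_isContinuousDensity_armMeasure n
  obtain ⟨C, hC0, hC, hint⟩ := exists_lintegral_restrictedMeasure hm hij hc0 hc
  have hpi := Real.pi_pos
  have hclosed := subspaceMeasure_eq hdens
  rw [← closedMeasure] at hclosed
  generalize restrictedMeasure (fun e : Arm n => c * ∏ l, besselE 0 (e l)) = R at hclosed hint
  have htotal : R Set.univ = C * besselE (m + 2) 0 := by
    have h := hint (fun _ => 1) measurable_const
    simpa only [lintegral_const, one_mul, lintegral_besselE_three] using h
  have hZ0 : C * besselE (m + 2) 0 ≠ 0 :=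
    mul_ne_zero hC0 (besselE_add_two_apply_zero_ne_zero m)
  have hZ : C * besselE (m + 2) 0 ≠ ∞ :=
    ENNReal.mul_ne_top hC (besselE_add_two_apply_zero_ne_top m)
  have hprob : IsProbabilityMeasure (closedMeasure n) :=
    ⟨by rw [hclosed, Measure.smul_apply, smul_eq_mul, htotal, ENNReal.inv_mul_cancel hZ0 hZ]⟩
  have hangle : ∫⁻ e, ENNReal.ofReal (turningAngle i j e) ∂(closedMeasure n) =
      ENNReal.ofReal (Real.pi * ((m + 2) / (2 * m + 3))) := by
    have h := hint (fun z => ENNReal.ofReal (InnerProductGeometry.angle z.1 z.2))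
      measurable_angle.ennreal_ofReal
    rw [lintegral_angle_mul_besselE] at h
    rw [hclosed, lintegral_smul_measure, smul_eq_mul, htotal]
    simp only [turningAngle]
    rw [h, mul_left_comm C, mul_left_comm, ENNReal.inv_mul_cancel hZ0 hZ, mul_one]
  have hexp : ∫ e, turningAngle i j e ∂(closedMeasure n) =
      Real.pi * ((m + 2) / (2 * m + 3)) := by
    rw [integral_eq_lintegral_of_nonneg_ae (Filter.Eventually.of_forall (turningAngle_nonneg i j))
      (measurable_turningAngle i j).aestronglyMeasurable, hangle, ENNReal.toReal_ofReal (by positivity)]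
  exact ⟨hprob, Integrable.of_bound (measurable_turningAngle i j).aestronglyMeasurable Real.pi
    (Filter.Eventually.of_forall (norm_turningAngle_le i j)), hexp⟩

end HopfGaussian

end

theorem proposition10 (n : ℕ) (hn : 3 ≤ n) (i j : Fin n) (hij : i ≠ j) :
    MeasureTheory.IsProbabilityMeasure (HopfGaussian.closedMeasure n) ∧
    MeasureTheory.Integrable (HopfGaussian.turningAngle i j) (HopfGaussian.closedMeasure n) ∧
    ∫ e, HopfGaussian.turningAngle i j e ∂(HopfGaussian.closedMeasure n)
      = Real.pi / 2 + Real.pi / 4 * (2 / (2 * (n : ℝ) - 3)) ∧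
    ∫ e, HopfGaussian.turningAngle i j e ∂(HopfGaussian.closedMeasure n)
      = ((n : ℝ) - 1) * Real.pi / (2 * (n : ℝ) - 3) := by
  obtain ⟨m, hm⟩ := Nat.exists_eq_add_of_le' hn
  obtain ⟨hprob, hint, hexp⟩ := HopfGaussian.integral_turningAngle hm hij
  have h3 : 2 * (n : ℝ) - 3 = 2 * m + 3 := by rw [hm]; push_cast; ring
  refine ⟨hprob, hint, ?_, ?_⟩
  · rw [hexp, h3]
    field_simp
    ring
  · rw [hexp, h3, hm]
    push_cast
    field_simp
    ring
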